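/- All vector spaces and algebras are over $\mathbb C$; algebras and homomorphisms are unital; "complete locally convex space" means complete and Hausdorff; $\widehat\otimes$ is the complete projective tensor product. A Hopf $\widehat\otimes$-algebra is a Hopf algebra in the monoidal category of complete locally convex spaces with $\widehat\otimes$; a homomorphism of Hopf $\widehat\otimes$-algebras is a continuous algebra homomorphism compatible with comultiplications, counits and antipodes. An Arens–Michael algebra is a complete Hausdorff topological algebra whose topology is given by a family of submultiplicative seminorms. An Arens–Michael envelope of a topological algebra $A$ is an Arens–Michael algebra $\widehat A$ with a continuous homomorphism $\iota_A\colon A\to\widehat A$ through which every continuous homomorphism from $A$ to an Arens–Michael algebra factors uniquely (by a continuous homomorphism). A Fréchet (that is, metrizable) Arens–Michael algebra $A$ is holomorphically finitely generated (HFG) if there are $x_1,\dots,x_n\in A$ such that every $a\in A$ has the form $a=\sum_{w}c_w x_w$, where $w$ runs over the words in $1,\dots,n$, $x_w$ is the corresponding product of generators, and $\sum_w|c_w|\rho^{|w|}<\infty$ for all $\rho>0$. An HFG Hopf algebra is a Hopf $\widehat\otimes$-algebra whose underlying algebra is an HFG algebra. **Proposition.** Let $H$ be an affine Hopf algebra,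 i.e. a Hopf algebra over $\mathbb C$ that is finitely generated as an algebra, endowed with the strongest locally convex topology. Then $H$, with its own operations (the comultiplication being composed with the canonical map $H\otimes H\to H\widehat\otimes H$), is a Hopf $\widehat\otimes$-algebra; $H$ has an Arens–Michael envelope; and for every Arens–Michael envelope $\iota_H\colon H\to\widehat H$, the algebra $\widehat H$ is HFG and carries a Hopf $\widehat\otimes$-algebra structure (so that it is an HFG Hopf algebra) for which $\iota_H$ is a homomorphism of Hopf $\widehat\otimes$-algebras. -/

import Mathlib

open scoped TensorProduct Topology

universe u

noncomputable section

/-! ### Topologies defined by families of seminorms -/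

section Seminorms

/-- The (additive-group) uniform structure on a complex vector space generated by a family of
seminorms. -/
abbrev seminormUniformSpace {ι E : Type*} [AddCommGroup E] [Module ℂ E]
    (p : ι → Seminorm ℂ E) : UniformSpace E :=
  ⨅ i, (p i).toSeminormedAddCommGroup.toUniformSpace

theorem seminormUniformSpace_isUniformAddGroup {ι E : Type*} [AddCommGroup E] [Module ℂ E]
    (p : ι → Seminorm ℂ E) : @IsUniformAddGroup E (seminormUniformSpace p) _ :=
  isUniformAddGroup_iInf fun i => by
    let := (p i).toSeminormedAddCommGroup
    infer_instance

theorem seminormUniformSpace_withSeminorms {ι E : Type*} [AddCommGroup E] [Module ℂ E]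
    (p : ι → Seminorm ℂ E) :
    @WithSeminorms ℂ E ι _ _ _ p (seminormUniformSpace p).toTopologicalSpace := by
  let := seminormUniformSpace p
  have := seminormUniformSpace_isUniformAddGroup p
  exact (SeminormFamily.withSeminorms_iff_uniformSpace_eq_iInf p).2 rfl

theorem exists_seminorm_lt_one_subset {E : Type*} [AddCommGroup E] [Module ℂ E]
    [TopologicalSpace E] [PolynormableSpace ℂ E] (W : Set E) (hW : W ∈ 𝓝 (0 : E)) :
    ∃ p : Seminorm ℂ E, Continuous p ∧ ∀ x, p x < 1 → x ∈ W := by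
  have hE := PolynormableSpace.withSeminorms ℂ E
  have := hE.topologicalAddGroup
  obtain ⟨s, ε, hε, hs⟩ := (hE.mem_nhds_iff 0 W).1 hW
  let p : Seminorm ℂ E := s.sup (fun p : {p : Seminorm ℂ E // Continuous p} ↦ p.1)
  have hcont : Continuous p := Seminorm.continuous_finsetSup fun i _ => i.2
  refine ⟨Real.toNNReal ε⁻¹ • p, hcont.const_smul (Real.toNNReal ε⁻¹), fun x hx => hs ?_⟩
  rw [Seminorm.mem_ball, sub_zero]
  have h : (Real.toNNReal ε⁻¹ : ℝ) * p x < 1 := hx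
  rwa [Real.coe_toNNReal _ (inv_nonneg.2 hε.le), inv_mul_lt_one₀ hε] at h

/-- In locally convex spaces a jointly continuous bilinear map is bounded by products of
continuous seminorms. -/
theorem exists_seminorm_bound_of_continuous {E F G : Type*}
    [AddCommGroup E] [Module ℂ E] [TopologicalSpace E] [PolynormableSpace ℂ E]
    [AddCommGroup F] [Module ℂ F] [TopologicalSpace F] [PolynormableSpace ℂ F]
    [AddCommGroup G] [Module ℂ G] [TopologicalSpace G]
    (B : E →ₗ[ℂ] F →ₗ[ℂ] G) (hB : Continuous fun z : E × F => B z.1 z.2)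
    (r : Seminorm ℂ G) (hr : Continuous r) :
    ∃ p : Seminorm ℂ E, Continuous p ∧ ∃ q : Seminorm ℂ F, Continuous q ∧
      ∀ x y, r (B x y) ≤ p x * q y := by
  have hE := PolynormableSpace.withSeminorms ℂ E
  have hF := PolynormableSpace.withSeminorms ℂ F
  have := hE.topologicalAddGroup
  have := hF.topologicalAddGroup
  have hc : ContinuousAt (fun z : E × F => r (B z.1 z.2)) (0, 0) :=
    (hr.comp hB).continuousAt
  have h1 : ∀ᶠ z : E × F in 𝓝 (0, 0), r (B z.1 z.2) < 1 := by
    refine hc.eventually_lt continuousAt_const ?_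
    simp
  rw [nhds_prod_eq] at h1
  obtain ⟨U, hU, V, hV, hUV⟩ := Filter.mem_prod_iff.1 h1
  have hp : ∃ p : Seminorm ℂ E, Continuous p ∧ ∀ x, p x < 1 → x ∈ U := exists_seminorm_lt_one_subset U hU
  have hq : ∃ p : Seminorm ℂ F, Continuous p ∧ ∀ x, p x < 1 → x ∈ V := exists_seminorm_lt_one_subset V hV
  obtain ⟨p, hpc, hp⟩ := hp
  obtain ⟨q, hqc, hq⟩ := hq
  refine ⟨p, hpc, q, hqc, fun x y => ?_⟩
  have step : ∀ ε : ℝ, 0 < ε → r (B x y) ≤ (p x + ε) * (q y + ε) := by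
    intro ε hε
    have ha : 0 < p x + ε := by have := apply_nonneg p x; linarith
    have hb : 0 < q y + ε := by have := apply_nonneg q y; linarith
    have hx : p (((p x + ε : ℝ) : ℂ)⁻¹ • x) < 1 := by
      rw [map_smul_eq_mul, norm_inv, Complex.norm_real, Real.norm_of_nonneg ha.le,
        inv_mul_lt_one₀ ha]
      linarith
    have hy : q (((q y + ε : ℝ) : ℂ)⁻¹ • y) < 1 := by
      rw [map_smul_eq_mul, norm_inv, Complex.norm_real, Real.norm_of_nonneg hb.le,
        inv_mul_lt_one₀ hb]
      linarith
    have h2 : r (B (((p x + ε : ℝ) : ℂ)⁻¹ • x) (((q y + ε : ℝ) : ℂ)⁻¹ • y)) < 1 :=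
      hUV (Set.mk_mem_prod (hp _ hx) (hq _ hy))
    rw [map_smul (B _), map_smul B, LinearMap.smul_apply, map_smul_eq_mul, map_smul_eq_mul, norm_inv,
      norm_inv, Complex.norm_real, Complex.norm_real, Real.norm_of_nonneg ha.le,
      Real.norm_of_nonneg hb.le, inv_mul_lt_iff₀ hb, inv_mul_lt_iff₀ ha] at h2
    nlinarith
  have hlim : Filter.Tendsto (fun ε : ℝ => (p x + ε) * (q y + ε)) (𝓝[>] 0) (𝓝 (p x * q y)) := by
    have : Continuous fun ε : ℝ => (p x + ε) * (q y + ε) := by fun_prop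
    have h := this.tendsto 0
    simp only [add_zero] at h
    exact h.mono_left nhdsWithin_le_nhds
  exact ge_of_tendsto hlim (Filter.eventually_of_mem self_mem_nhdsWithin fun ε hε => step ε hε)

end Seminorms

/-! ### Completions of locally convex spaces -/

section Completion

open UniformSpace

variable {E : Type*} [AddCommGroup E] [Module ℂ E] [UniformSpace E] [IsUniformAddGroup E]
  [UniformContinuousConstSMul ℂ E]

theorem Seminorm.coe_completionExtension (p : Seminorm ℂ E) (hp : Continuous p) (x : E) :
    Completion.extension (p : E → ℝ) (x : Completion E) = p x :=
  Completion.extension_coe (Seminorm.uniformContinuous_of_continuousAt_zero hp.continuousAt) x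

/-- The extension by continuity of a continuous seminorm to the completion. -/
def Seminorm.completionExtension (p : Seminorm ℂ E) (hp : Continuous p) :
    Seminorm ℂ (Completion E) :=
  Seminorm.of (Completion.extension p)
    (fun x y => by
      refine Completion.induction_on₂ x y (isClosed_le ?_ ?_) fun a b => ?_
      · exact Completion.continuous_extension.comp continuous_add
      · exact (Completion.continuous_extension.comp continuous_fst).add
          (Completion.continuous_extension.comp continuous_snd)
      · rw [← Completion.coe_add]
        simp only [Seminorm.coe_completionExtension p hp]
        exact map_add_le_add p a b)
    (fun c x => by
      refine Completion.induction_on x (isClosed_eq ?_ ?_) fun a => ?_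
      · exact Completion.continuous_extension.comp (continuous_const_smul c)
      · exact continuous_const.mul Completion.continuous_extension
      · rw [← Completion.coe_smul]
        simp only [Seminorm.coe_completionExtension p hp]
        exact map_smul_eq_mul p c a)

theorem Seminorm.completionExtension_coe (p : Seminorm ℂ E) (hp : Continuous p) (x : E) :
    p.completionExtension hp (x : Completion E) = p x :=
  Seminorm.coe_completionExtension p hp x

theorem Seminorm.continuous_completionExtension (p : Seminorm ℂ E) (hp : Continuous p) :
    Continuous (p.completionExtension hp) :=
  Completion.continuous_extension

/-- The completion of a locally convex space is locally convex. -/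
instance Completion.instPolynormableSpace [PolynormableSpace ℂ E] :
    PolynormableSpace ℂ (Completion E) := by
  have hE := PolynormableSpace.withSeminorms ℂ E
  let P : SeminormFamily ℂ (Completion E) {p : Seminorm ℂ E // Continuous p} :=
    fun p => p.1.completionExtension p.2
  suffices h : WithSeminorms P from h.toPolynormableSpace
  rw [SeminormFamily.withSeminorms_iff_nhds_eq_iInf]
  refine le_antisymm ?_ ?_
  · simp_rw [le_iInf_iff, ← Filter.tendsto_iff_comap]
    intro p
    exact (Seminorm.continuous_completionExtension p.1 p.2).tendsto' 0 0 (map_zero _)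
  · intro V hV
    obtain ⟨W, hW, hWc, hWV⟩ := exists_mem_nhds_isClosed_subset hV
    have hW' : ((↑) : E → Completion E) ⁻¹' W ∈ 𝓝 (0 : E) :=
      (Completion.continuous_coe E).continuousAt (by rwa [Completion.coe_zero])
    obtain ⟨p, hp, hs⟩ := exists_seminorm_lt_one_subset _ hW'
    refine Filter.mem_iInf_of_mem ⟨p, hp⟩ ⟨Set.Iio 1, Iio_mem_nhds one_pos, ?_⟩
    refine subset_trans ?_ hWV
    intro x hx
    have hopen : IsOpen {x : Completion E | p.completionExtension hp x < 1} :=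
      isOpen_lt (Seminorm.continuous_completionExtension _ hp) continuous_const
    have hcl := Completion.denseRange_coe.open_subset_closure_inter hopen hx
    refine hWc.closure_subset_iff.2 ?_ hcl
    rintro _ ⟨hy, y, rfl⟩
    apply hs
    rwa [Set.mem_ofPred_eq, Seminorm.completionExtension_coe] at hy

instance Completion.instContinuousSMul [PolynormableSpace ℂ E] :
    ContinuousSMul ℂ (Completion E) :=
  (PolynormableSpace.withSeminorms ℂ (Completion E)).continuousSMul

end Completion

/-! ### The projective tensor product -/

section Projective

variable {E F G E' F' : Type*}
  [AddCommGroup E] [Module ℂ E] [AddCommGroup F] [Module ℂ F] [AddCommGroup G] [Module ℂ G]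
  [AddCommGroup E'] [Module ℂ E'] [AddCommGroup F'] [Module ℂ F']

/-- The costs `∑ᵢ p xᵢ * q yᵢ` of all representations `u = ∑ᵢ xᵢ ⊗ yᵢ`. -/
def projCosts (p : Seminorm ℂ E) (q : Seminorm ℂ F) (u : E ⊗[ℂ] F) : Set ℝ :=
  {c | ∃ l : List (E × F), (l.map fun z => z.1 ⊗ₜ[ℂ] z.2).sum = u ∧
    (l.map fun z => p z.1 * q z.2).sum = c}

theorem projCosts_nonneg (p : Seminorm ℂ E) (q : Seminorm ℂ F) (u : E ⊗[ℂ] F) :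
    ∀ c ∈ projCosts p q u, 0 ≤ c := by
  rintro c ⟨l, -, rfl⟩
  refine List.sum_nonneg ?_
  intro c hc
  obtain ⟨z, -, rfl⟩ := List.mem_map.1 hc
  exact mul_nonneg (apply_nonneg p _) (apply_nonneg q _)

theorem projCosts_bddBelow (p : Seminorm ℂ E) (q : Seminorm ℂ F) (u : E ⊗[ℂ] F) :
    BddBelow (projCosts p q u) :=
  ⟨0, projCosts_nonneg p q u⟩

theorem projCosts_nonempty (p : Seminorm ℂ E) (q : Seminorm ℂ F) (u : E ⊗[ℂ] F) :
    (projCosts p q u).Nonempty := by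
  induction u with
  | zero => exact ⟨0, [], by simp, by simp⟩
  | tmul x y => exact ⟨_, [(x, y)], by simp, rfl⟩
  | add u v hu hv =>
    obtain ⟨_, l, hl, -⟩ := hu
    obtain ⟨_, l', hl', -⟩ := hv
    exact ⟨_, l ++ l', by simp [hl, hl'], rfl⟩

/-- The projective tensor product `p ⊗ q` of two seminorms:
`(p ⊗ q)(u) = inf {∑ᵢ p xᵢ * q yᵢ | u = ∑ᵢ xᵢ ⊗ yᵢ}`. -/
def projSeminorm (p : Seminorm ℂ E) (q : Seminorm ℂ F) : Seminorm ℂ (E ⊗[ℂ] F) :=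
  Seminorm.ofSMulLE (fun u => sInf (projCosts p q u))
    (le_antisymm (csInf_le (projCosts_bddBelow p q 0) ⟨[], by simp, by simp⟩)
      (le_csInf (projCosts_nonempty p q 0) (projCosts_nonneg p q 0)))
    (fun u v => by
      refine le_of_forall_pos_le_add fun ε hε => ?_
      obtain ⟨a, ⟨l, hl, rfl⟩, ha⟩ :=
        exists_lt_of_csInf_lt (projCosts_nonempty p q u)
          (lt_add_of_pos_right (sInf (projCosts p q u)) (half_pos hε))
      obtain ⟨b, ⟨l', hl', rfl⟩, hb⟩ :=
        exists_lt_of_csInf_lt (projCosts_nonempty p q v)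
          (lt_add_of_pos_right (sInf (projCosts p q v)) (half_pos hε))
      refine (csInf_le (projCosts_bddBelow p q (u + v))
        ⟨l ++ l', by simp [hl, hl'], rfl⟩).trans ?_
      rw [List.map_append, List.sum_append]
      linarith)
    (fun c u => by
      rcases eq_or_ne c 0 with rfl | hc
      · rw [zero_smul, norm_zero, zero_mul]
        exact csInf_le (projCosts_bddBelow p q 0) ⟨[], by simp, by simp⟩
      · have hc' : 0 < ‖c‖ := norm_pos_iff.2 hc
        rw [← div_le_iff₀' hc']
        refine le_csInf (projCosts_nonempty p q u) ?_
        rintro a ⟨l, hl, rfl⟩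
        rw [div_le_iff₀' hc']
        refine csInf_le (projCosts_bddBelow p q (c • u))
          ⟨l.map fun z => (c • z.1, z.2), ?_, ?_⟩
        · rw [← hl, List.smul_sum, List.map_map, List.map_map]
          rfl
        · rw [← List.sum_map_mul_left, List.map_map]
          congr 1
          refine List.map_congr_left fun z _ => ?_
          simp only [Function.comp, map_smul_eq_mul, mul_assoc])

theorem projSeminorm_apply (p : Seminorm ℂ E) (q : Seminorm ℂ F) (u : E ⊗[ℂ] F) :
    projSeminorm p q u = sInf (projCosts p q u) := rfl

theorem projSeminorm_tmul_le (p : Seminorm ℂ E) (q : Seminorm ℂ F) (x : E) (y : F) :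
    projSeminorm p q (x ⊗ₜ y) ≤ p x * q y :=
  csInf_le (projCosts_bddBelow p q _) ⟨[(x, y)], by simp, by simp⟩

theorem le_projSeminorm (p : Seminorm ℂ E) (q : Seminorm ℂ F) (s : Seminorm ℂ (E ⊗[ℂ] F))
    {C : ℝ} (hC : 0 ≤ C) (h : ∀ x y, s (x ⊗ₜ y) ≤ C * (p x * q y)) (u : E ⊗[ℂ] F) :
    s u ≤ C * projSeminorm p q u := by
  have key : ∀ c ∈ projCosts p q u, s u ≤ C * c := by
    rintro c ⟨l, rfl, rfl⟩
    induction l with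
    | nil => simp
    | cons z l ih =>
      simp only [List.map_cons, List.sum_cons, mul_add]
      exact (map_add_le_add s _ _).trans (add_le_add (h _ _) ih)
  rw [projSeminorm_apply]
  rcases hC.eq_or_lt with rfl | hC
  · obtain ⟨c, hc⟩ := projCosts_nonempty p q u
    simpa using key c hc
  · rw [← div_le_iff₀' hC]
    refine le_csInf (projCosts_nonempty p q u) fun c hc => ?_
    rw [div_le_iff₀' hC]
    exact key c hc

variable (E F) in
/-- The algebraic tensor product `E ⊗ F`, to be endowed with the projective topology. -/
def ProjTensor : Type _ := E ⊗[ℂ] F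

instance : AddCommGroup (ProjTensor E F) := inferInstanceAs (AddCommGroup (E ⊗[ℂ] F))

instance : Module ℂ (ProjTensor E F) := inferInstanceAs (Module ℂ (E ⊗[ℂ] F))

/-- The identity map, from `E ⊗ F` to `E ⊗ F` with the projective topology. -/
def toProj : E ⊗[ℂ] F ≃ₗ[ℂ] ProjTensor E F := LinearEquiv.refl ℂ (E ⊗[ℂ] F)

/-- The seminorm `p ⊗ q`, on `ProjTensor E F`. -/
def ProjTensor.seminorm (p : Seminorm ℂ E) (q : Seminorm ℂ F) : Seminorm ℂ (ProjTensor E F) :=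
  (projSeminorm p q).comp toProj.symm.toLinearMap

theorem ProjTensor.seminorm_toProj (p : Seminorm ℂ E) (q : Seminorm ℂ F) (u : E ⊗[ℂ] F) :
    ProjTensor.seminorm p q (toProj u) = projSeminorm p q u := rfl

variable [TopologicalSpace E] [TopologicalSpace F] [TopologicalSpace E'] [TopologicalSpace F']

variable (E F) in
/-- The family of the seminorms `p ⊗ q`, for continuous seminorms `p` on `E` and `q` on `F`. -/
def projSeminormFamily :
    {p : Seminorm ℂ E // Continuous p} × {q : Seminorm ℂ F // Continuous q} →
      Seminorm ℂ (ProjTensor E F) :=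
  fun pq => ProjTensor.seminorm pq.1.1 pq.2.1

/-- The projective topology on `E ⊗ F`. -/
instance : UniformSpace (ProjTensor E F) := seminormUniformSpace (projSeminormFamily E F)

instance : IsUniformAddGroup (ProjTensor E F) :=
  seminormUniformSpace_isUniformAddGroup (projSeminormFamily E F)

theorem ProjTensor.withSeminorms : WithSeminorms (projSeminormFamily E F) :=
  seminormUniformSpace_withSeminorms (projSeminormFamily E F)

instance : PolynormableSpace ℂ (ProjTensor E F) :=
  ProjTensor.withSeminorms.toPolynormableSpace

instance : ContinuousSMul ℂ (ProjTensor E F) :=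
  ProjTensor.withSeminorms.continuousSMul

instance : UniformContinuousConstSMul ℂ (ProjTensor E F) :=
  uniformContinuousConstSMul_of_continuousConstSMul _ _

theorem ProjTensor.continuous_seminorm (p : Seminorm ℂ E) (hp : Continuous p)
    (q : Seminorm ℂ F) (hq : Continuous q) :
    Continuous (ProjTensor.seminorm p q) :=
  ProjTensor.withSeminorms.continuous_seminorm (⟨p, hp⟩, ⟨q, hq⟩)

/-- A continuous seminorm for the projective topology is bounded by some `p ⊗ q`. -/
theorem ProjTensor.exists_bound (s : Seminorm ℂ (ProjTensor E F)) (hs : Continuous s) :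
    ∃ p : Seminorm ℂ E, Continuous p ∧ ∃ q : Seminorm ℂ F, Continuous q ∧
      ∀ (x : E) (y : F), s (toProj (x ⊗ₜ y)) ≤ p x * q y := by
  obtain ⟨t, C, -, hC⟩ := Seminorm.bound_of_continuous ProjTensor.withSeminorms s hs
  refine ⟨C • ∑ i ∈ t, i.1.1, ?_, ∑ i ∈ t, i.2.1, ?_, fun x y => ?_⟩
  · exact (Seminorm.continuous_finsetSum fun i _ => i.1.2).const_smul C
  · exact Seminorm.continuous_finsetSum fun i _ => i.2.2
  · refine (hC _).trans ?_
    have hsum : ∀ (r : _ → Seminorm ℂ E) (x : E), (∑ i ∈ t, r i) x = ∑ i ∈ t, r i x := by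
      intro r x
      classical
      induction t using Finset.induction_on with
      | empty => simp
      | insert a t ha ih => simp [Finset.sum_insert ha]
    have hsum' : ∀ (r : _ → Seminorm ℂ F) (x : F), (∑ i ∈ t, r i) x = ∑ i ∈ t, r i x := by
      intro r x
      classical
      induction t using Finset.induction_on with
      | empty => simp
      | insert a t ha ih => simp [Finset.sum_insert ha]
    have h1 : (t.sup (projSeminormFamily E F)) (toProj (x ⊗ₜ y)) ≤
        (∑ i ∈ t, i.1.1) x * (∑ i ∈ t, i.2.1) y := by
      refine Seminorm.finset_sup_apply_le (mul_nonneg (apply_nonneg _ _) (apply_nonneg _ _))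
        fun i hi => ?_
      refine (projSeminorm_tmul_le i.1.1 i.2.1 x y).trans ?_
      rw [hsum, hsum']
      exact mul_le_mul
        (Finset.single_le_sum (f := fun i => i.1.1 x) (fun j _ => apply_nonneg j.1.1 x) hi)
        (Finset.single_le_sum (f := fun i => i.2.1 y) (fun j _ => apply_nonneg j.2.1 y) hi)
        (apply_nonneg _ _) (Finset.sum_nonneg fun j _ => apply_nonneg j.1.1 x)
    calc (C • t.sup (projSeminormFamily E F)) (toProj (x ⊗ₜ y))
        = (C : ℝ) * (t.sup (projSeminormFamily E F)) (toProj (x ⊗ₜ y)) := rfl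
      _ ≤ (C : ℝ) * ((∑ i ∈ t, i.1.1) x * (∑ i ∈ t, i.2.1) y) :=
          mul_le_mul_of_nonneg_left h1 C.2
      _ = (C • ∑ i ∈ t, i.1.1) x * (∑ i ∈ t, i.2.1) y := by
          rw [← mul_assoc]; rfl

/-- The continuous linear map on `E ⊗ F` induced by a linear map that is bounded on pure tensors
by products of continuous seminorms. -/
def ProjTensor.mkCLM [TopologicalSpace G] [PolynormableSpace ℂ G] (f : E ⊗[ℂ] F →ₗ[ℂ] G)
    (hf : ∀ r : Seminorm ℂ G, Continuous r → ∃ p : Seminorm ℂ E, Continuous p ∧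
      ∃ q : Seminorm ℂ F, Continuous q ∧ ∀ x y, r (f (x ⊗ₜ y)) ≤ p x * q y) :
    ProjTensor E F →L[ℂ] G :=
  { (f ∘ₗ toProj.symm.toLinearMap : ProjTensor E F →ₗ[ℂ] G) with
    cont := by
      refine (PolynormableSpace.withSeminorms ℂ G).continuous_of_continuous_comp
        (f ∘ₗ toProj.symm.toLinearMap : ProjTensor E F →ₗ[ℂ] G) fun r => ?_
      obtain ⟨p, hp, q, hq, h⟩ := hf r.1 r.2
      refine Seminorm.continuous_of_le (ProjTensor.continuous_seminorm p hp q hq) fun u => ?_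
      have := le_projSeminorm p q (r.1.comp f) zero_le_one (fun x y => by simpa using h x y)
        (toProj.symm u)
      rw [one_mul] at this
      exact this }

theorem ProjTensor.mkCLM_toProj [TopologicalSpace G] [PolynormableSpace ℂ G]
    (f : E ⊗[ℂ] F →ₗ[ℂ] G)
    (hf : ∀ r : Seminorm ℂ G, Continuous r → ∃ p : Seminorm ℂ E, Continuous p ∧
      ∃ q : Seminorm ℂ F, Continuous q ∧ ∀ x y, r (f (x ⊗ₜ y)) ≤ p x * q y) (u : E ⊗[ℂ] F) :
    ProjTensor.mkCLM f hf (toProj u) = f u := rfl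

/-- The algebraic map `f ⊗ g`, continuous for the projective topologies. -/
def ProjTensor.map (f : E →L[ℂ] E') (g : F →L[ℂ] F') : ProjTensor E F →L[ℂ] ProjTensor E' F' :=
  ProjTensor.mkCLM (toProj.toLinearMap ∘ₗ TensorProduct.map f.toLinearMap g.toLinearMap)
    fun r hr => by
      obtain ⟨p, hp, q, hq, h⟩ := ProjTensor.exists_bound r hr
      exact ⟨p.comp f.toLinearMap, hp.comp f.continuous, q.comp g.toLinearMap,
        hq.comp g.continuous, fun x y => h (f x) (g y)⟩

/-! ### The complete projective tensor product -/

variable (E F) in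
/-- The complete projective tensor product: the (Hausdorff) completion of `E ⊗ F` in the
projective topology. -/
abbrev CompletedTensor : Type _ := UniformSpace.Completion (ProjTensor E F)

namespace CompletedTensor

/-- The canonical linear map from the algebraic tensor product to the completed one. -/
def ofTensor : E ⊗[ℂ] F →ₗ[ℂ] CompletedTensor E F where
  toFun u := UniformSpace.Completion.coe' (toProj u)
  map_add' u v := by rw [map_add, UniformSpace.Completion.coe_add]
  map_smul' c u := by
    rw [map_smul, UniformSpace.Completion.coe_smul, RingHom.id_apply]

theorem ofTensor_apply (u : E ⊗[ℂ] F) :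
    ofTensor u = UniformSpace.Completion.coe' (toProj u) := rfl

end CompletedTensor

/-- The elementary tensor `x ⊗ y` in the complete projective tensor product. -/
def ctmul (x : E) (y : F) : CompletedTensor E F :=
  CompletedTensor.ofTensor (x ⊗ₜ y)

namespace CompletedTensor

variable (E F) in
/-- The canonical bilinear map `(x, y) ↦ x ⊗ y`. -/
def mk : E →ₗ[ℂ] F →ₗ[ℂ] CompletedTensor E F :=
  (TensorProduct.mk ℂ E F).compr₂ ofTensor

theorem mk_apply (x : E) (y : F) : mk E F x y = ctmul x y := rfl

theorem exists_bound (s : Seminorm ℂ (CompletedTensor E F)) (hs : Continuous s) :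
    ∃ p : Seminorm ℂ E, Continuous p ∧ ∃ q : Seminorm ℂ F, Continuous q ∧
      ∀ (x : E) (y : F), s (ctmul x y) ≤ p x * q y :=
  ProjTensor.exists_bound (s.comp (ofTensor ∘ₗ toProj.symm.toLinearMap))
    (hs.comp (UniformSpace.Completion.continuous_coe (ProjTensor E F)))

/-- The complete projective tensor product of continuous linear maps. -/
def map (f : E →L[ℂ] E') (g : F →L[ℂ] F') : CompletedTensor E F →L[ℂ] CompletedTensor E' F' :=
  (ProjTensor.map f g).completion

theorem map_ctmul (f : E →L[ℂ] E') (g : F →L[ℂ] F') (x : E) (y : F) :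
    map f g (ctmul x y) = ctmul (f x) (g y) := by
  rw [map, ctmul, ofTensor_apply, ContinuousLinearMap.completion_apply_coe]
  rfl

/-- Two continuous linear maps that agree on elementary tensors are equal. -/
theorem ext_ctmul [TopologicalSpace G] [T2Space G] {f g : CompletedTensor E F →L[ℂ] G}
    (h : ∀ x y, f (ctmul x y) = g (ctmul x y)) : f = g := by
  ext u
  refine UniformSpace.Completion.induction_on u (isClosed_eq f.continuous g.continuous)
    fun a => ?_
  have : f.toLinearMap ∘ₗ ofTensor = g.toLinearMap ∘ₗ (ofTensor : E ⊗[ℂ] F →ₗ[ℂ] _) :=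
    TensorProduct.ext' h
  exact LinearMap.congr_fun this (toProj.symm a)

end CompletedTensor

end Projective

section Lift

variable {E F G : Type*}
  [AddCommGroup E] [Module ℂ E] [TopologicalSpace E]
  [AddCommGroup F] [Module ℂ F] [TopologicalSpace F]
  [AddCommGroup G] [Module ℂ G]

namespace CompletedTensor

variable [UniformSpace G] [IsUniformAddGroup G]
  [UniformContinuousConstSMul ℂ G] [PolynormableSpace ℂ G] [CompleteSpace G] [T2Space G]

/-- The continuous linear map with values in a complete locally convex space that is induced by a
bilinear map bounded by products of continuous seminorms. -/
def lift (B : E →ₗ[ℂ] F →ₗ[ℂ] G)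
    (hB : ∀ r : Seminorm ℂ G, Continuous r → ∃ p : Seminorm ℂ E, Continuous p ∧
      ∃ q : Seminorm ℂ F, Continuous q ∧ ∀ x y, r (B x y) ≤ p x * q y) :
    CompletedTensor E F →L[ℂ] G :=
  (ProjTensor.mkCLM (TensorProduct.lift B) (by simpa using hB)).fromCompletion

theorem lift_ctmul (B : E →ₗ[ℂ] F →ₗ[ℂ] G)
    (hB : ∀ r : Seminorm ℂ G, Continuous r → ∃ p : Seminorm ℂ E, Continuous p ∧
      ∃ q : Seminorm ℂ F, Continuous q ∧ ∀ x y, r (B x y) ≤ p x * q y) (x : E) (y : F) :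
    lift B hB (ctmul x y) = B x y := by
  rw [lift, ctmul, ofTensor_apply, ContinuousLinearMap.fromCompletion_apply_coe,
    ProjTensor.mkCLM_toProj, TensorProduct.lift.tmul]

end CompletedTensor

end Lift

section Assoc

variable (E F G : Type*)
  [AddCommGroup E] [Module ℂ E] [TopologicalSpace E]
  [AddCommGroup F] [Module ℂ F] [TopologicalSpace F]
  [AddCommGroup G] [Module ℂ G] [TopologicalSpace G]

namespace CompletedTensor

/-- The linear map `x ⊗ y ↦ x ⊗ (y ⊗ z)`, depending linearly on `z`. -/
def assocAux : E ⊗[ℂ] F →ₗ[ℂ] G →ₗ[ℂ] CompletedTensor E (CompletedTensor F G) :=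
  TensorProduct.lift
    (LinearMap.mk₂ ℂ (fun x y => (mk E (CompletedTensor F G) x) ∘ₗ (mk F G y))
      (by intros; ext; simp) (by intros; ext; simp) (by intros; ext; simp)
      (by intros; ext; simp))

theorem assocAux_tmul (x : E) (y : F) (z : G) :
    assocAux E F G (x ⊗ₜ y) z = ctmul x (ctmul y z) := rfl

theorem assocAux_bound (r : Seminorm ℂ (CompletedTensor E (CompletedTensor F G)))
    (hr : Continuous r) :
    ∃ p : Seminorm ℂ E, Continuous p ∧ ∃ q : Seminorm ℂ F, Continuous q ∧
      ∃ s : Seminorm ℂ G, Continuous s ∧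
        (∀ x y z, r (assocAux E F G (x ⊗ₜ y) z) ≤ p x * q y * s z) ∧
        ∀ u z, r (assocAux E F G u z) ≤ projSeminorm p q u * s z := by
  obtain ⟨p, hp, q', hq', h⟩ := exists_bound r hr
  obtain ⟨q, hq, s, hs, h'⟩ := exists_bound q' hq'
  have h1 : ∀ x y z, r (assocAux E F G (x ⊗ₜ y) z) ≤ p x * q y * s z := fun x y z => by
    rw [assocAux_tmul, mul_assoc]
    exact (h x (ctmul y z)).trans (mul_le_mul_of_nonneg_left (h' y z) (apply_nonneg p x))
  refine ⟨p, hp, q, hq, s, hs, h1, fun u z => ?_⟩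
  rw [mul_comm]
  exact le_projSeminorm p q (r.comp ((assocAux E F G).flip z)) (apply_nonneg s z)
    (fun x y => by rw [mul_comm]; exact h1 x y z) u

/-- The continuous linear extension of `x ⊗ y ↦ x ⊗ (y ⊗ z)`. -/
def assocAuxCLM (z : G) : CompletedTensor E F →L[ℂ] CompletedTensor E (CompletedTensor F G) :=
  (ProjTensor.mkCLM ((assocAux E F G).flip z) fun r hr => by
    obtain ⟨p, hp, q, hq, s, -, h, -⟩ := assocAux_bound E F G r hr
    refine ⟨Real.toNNReal (s z) • p, hp.const_smul (Real.toNNReal (s z)), q, hq,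
      fun x y => (h x y z).trans (le_of_eq ?_)⟩
    change p x * q y * s z = (Real.toNNReal (s z) : ℝ) * p x * q y
    rw [Real.coe_toNNReal _ (apply_nonneg s z)]
    ring).fromCompletion

theorem assocAuxCLM_ofTensor (z : G) (u : E ⊗[ℂ] F) :
    assocAuxCLM E F G z (ofTensor u) = assocAux E F G u z := by
  rw [assocAuxCLM, ofTensor_apply, ContinuousLinearMap.fromCompletion_apply_coe,
    ProjTensor.mkCLM_toProj, LinearMap.flip_apply]

/-- The bilinear map `(x ⊗ y, z) ↦ x ⊗ (y ⊗ z)`. -/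
def assocBilin : CompletedTensor E F →ₗ[ℂ] G →ₗ[ℂ] CompletedTensor E (CompletedTensor F G) :=
  LinearMap.mk₂ ℂ (fun u z => assocAuxCLM E F G z u)
    (fun u v z => map_add _ u v)
    (fun c u z => map_smul _ c u)
    (fun u z w => by
      have : assocAuxCLM E F G (z + w) = assocAuxCLM E F G z + assocAuxCLM E F G w :=
        ext_ctmul fun x y => by
          simp only [ctmul, add_apply, assocAuxCLM_ofTensor, map_add]
      rw [this]; rfl)
    (fun c u z => by
      have : assocAuxCLM E F G (c • z) = c • assocAuxCLM E F G z :=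
        ext_ctmul fun x y => by
          simp only [ctmul, smul_apply, assocAuxCLM_ofTensor, map_smul]
      rw [this]; rfl)

theorem assocBilin_bound (r : Seminorm ℂ (CompletedTensor E (CompletedTensor F G)))
    (hr : Continuous r) :
    ∃ p : Seminorm ℂ (CompletedTensor E F), Continuous p ∧ ∃ q : Seminorm ℂ G, Continuous q ∧
      ∀ u z, r (assocBilin E F G u z) ≤ p u * q z := by
  obtain ⟨p, hp, q, hq, s, hs, -, h⟩ := assocAux_bound E F G r hr
  have hc := ProjTensor.continuous_seminorm p hp q hq
  refine ⟨Seminorm.completionExtension (E := ProjTensor E F) (ProjTensor.seminorm p q) hc,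
    Seminorm.continuous_completionExtension _ hc, s, hs, fun u z => ?_⟩
  refine UniformSpace.Completion.induction_on u (isClosed_le ?_ ?_) fun a => ?_
  · exact hr.comp (assocAuxCLM E F G z).continuous
  · exact (Seminorm.continuous_completionExtension _ hc).mul continuous_const
  · rw [Seminorm.completionExtension_coe]
    exact (congrArg r (assocAuxCLM_ofTensor E F G z (toProj.symm a))).trans_le (h (toProj.symm a) z)

/-- The associativity constraint `(x ⊗ y) ⊗ z ↦ x ⊗ (y ⊗ z)` of the complete projective tensor
product. -/
def assoc :
    CompletedTensor (CompletedTensor E F) G →L[ℂ] CompletedTensor E (CompletedTensor F G) :=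
  lift (assocBilin E F G) (assocBilin_bound E F G)

theorem assoc_ctmul (x : E) (y : F) (z : G) :
    assoc E F G (ctmul (ctmul x y) z) = ctmul x (ctmul y z) := by
  rw [assoc, lift_ctmul]
  exact assocAuxCLM_ofTensor E F G z (x ⊗ₜ y)

end CompletedTensor

end Assoc

/-! ### Topological algebras -/

/-- A (unital) `⊗̂`-algebra: an associative algebra in the category of complete Hausdorff locally
convex spaces with the complete projective tensor product, i.e. a complete Hausdorff locally convex
space with a jointly continuous associative unital multiplication. -/
class ProjAlgebra (A : Type*) [Ring A] [Algebra ℂ A] [UniformSpace A] : Prop where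
  isUniformAddGroup : IsUniformAddGroup A
  polynormableSpace : PolynormableSpace ℂ A
  completeSpace : CompleteSpace A
  t2Space : T2Space A
  isTopologicalRing : IsTopologicalRing A

attribute [instance] ProjAlgebra.isUniformAddGroup ProjAlgebra.polynormableSpace
  ProjAlgebra.completeSpace ProjAlgebra.t2Space ProjAlgebra.isTopologicalRing

instance ProjAlgebra.continuousSMul (A : Type*) [Ring A] [Algebra ℂ A] [UniformSpace A]
    [ProjAlgebra A] : ContinuousSMul ℂ A :=
  (PolynormableSpace.withSeminorms ℂ A).continuousSMul

instance ProjAlgebra.uniformContinuousConstSMul (A : Type*) [Ring A] [Algebra ℂ A]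
    [UniformSpace A] [ProjAlgebra A] : UniformContinuousConstSMul ℂ A :=
  uniformContinuousConstSMul_of_continuousConstSMul _ _

section TensorAlgebra

variable (A B : Type*) [Ring A] [Algebra ℂ A] [Ring B] [Algebra ℂ B]

/-- `A ⊗ B` with the multiplication `(a ⊗ b) * (a' ⊗ b') = (a * a') ⊗ (b * b')`. -/
instance : Ring (ProjTensor A B) := inferInstanceAs (Ring (A ⊗[ℂ] B))

instance : Algebra ℂ (ProjTensor A B) := inferInstanceAs (Algebra ℂ (A ⊗[ℂ] B))

variable [UniformSpace A] [ProjAlgebra A] [UniformSpace B] [ProjAlgebra B]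

theorem ProjAlgebra.exists_mul_bound (r : Seminorm ℂ A) (hr : Continuous r) :
    ∃ p : Seminorm ℂ A, Continuous p ∧ ∃ q : Seminorm ℂ A, Continuous q ∧
      ∀ x y, r (x * y) ≤ p x * q y :=
  exists_seminorm_bound_of_continuous (LinearMap.mul ℂ A) continuous_mul r hr

theorem ProjTensor.exists_mul_bound (r : Seminorm ℂ (ProjTensor A B)) (hr : Continuous r) :
    ∃ p : Seminorm ℂ (ProjTensor A B), Continuous p ∧
      ∃ q : Seminorm ℂ (ProjTensor A B), Continuous q ∧ ∀ u v, r (u * v) ≤ p u * q v := by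
  obtain ⟨p, hp, q, hq, h⟩ := ProjTensor.exists_bound r hr
  obtain ⟨p₁, hp₁, p₂, hp₂, h₁⟩ := ProjAlgebra.exists_mul_bound A p hp
  obtain ⟨q₁, hq₁, q₂, hq₂, h₂⟩ := ProjAlgebra.exists_mul_bound B q hq
  refine ⟨ProjTensor.seminorm p₁ q₁, ProjTensor.continuous_seminorm p₁ hp₁ q₁ hq₁,
    ProjTensor.seminorm p₂ q₂, ProjTensor.continuous_seminorm p₂ hp₂ q₂ hq₂, fun u v => ?_⟩
  let r' : Seminorm ℂ (A ⊗[ℂ] B) := r.comp toProj.toLinearMap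
  have step : ∀ (a : A) (b : B) (v : A ⊗[ℂ] B),
      r' ((a ⊗ₜ b) * v) ≤ p₁ a * q₁ b * projSeminorm p₂ q₂ v := fun a b v =>
    le_projSeminorm p₂ q₂ (r'.comp (LinearMap.mulLeft ℂ (a ⊗ₜ[ℂ] b : A ⊗[ℂ] B)))
      (mul_nonneg (apply_nonneg _ _) (apply_nonneg _ _))
      (fun c d => by
        have e : r'.comp (LinearMap.mulLeft ℂ (a ⊗ₜ[ℂ] b : A ⊗[ℂ] B)) (c ⊗ₜ d)
            = r' ((a * c) ⊗ₜ (b * d)) := by simp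
        rw [e]
        calc r' ((a * c) ⊗ₜ (b * d)) ≤ p (a * c) * q (b * d) := h _ _
          _ ≤ (p₁ a * p₂ c) * (q₁ b * q₂ d) :=
              mul_le_mul (h₁ a c) (h₂ b d) (apply_nonneg _ _)
                (mul_nonneg (apply_nonneg _ _) (apply_nonneg _ _))
          _ = p₁ a * q₁ b * (p₂ c * q₂ d) := by ring) v
  have := le_projSeminorm p₁ q₁ (r'.comp (LinearMap.mulRight ℂ (v : A ⊗[ℂ] B)))
    (apply_nonneg (projSeminorm p₂ q₂) v)
    (fun a b => by rw [mul_comm]; exact step a b v) u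
  rw [mul_comm] at this
  exact this

instance : IsTopologicalRing (ProjTensor A B) where
  continuous_mul := by
    rw [continuous_iff_continuousAt]
    rintro ⟨u₀, v₀⟩
    refine ((PolynormableSpace.withSeminorms ℂ (ProjTensor A B)).tendsto_nhds _ _).2
      fun r ε hε => ?_
    obtain ⟨p, hp, q, hq, h⟩ := ProjTensor.exists_mul_bound A B r.1 r.2
    have hlim : Filter.Tendsto
        (fun z : ProjTensor A B × ProjTensor A B =>
          p (z.1 - u₀) * q z.2 + p u₀ * q (z.2 - v₀)) (𝓝 (u₀, v₀)) (𝓝 0) := by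
      have hc : Continuous fun z : ProjTensor A B × ProjTensor A B =>
          p (z.1 - u₀) * q z.2 + p u₀ * q (z.2 - v₀) := by fun_prop
      simpa using hc.tendsto (u₀, v₀)
    filter_upwards [hlim.eventually_lt_const hε] with z hz
    refine lt_of_le_of_lt ?_ hz
    have e : z.1 * z.2 - u₀ * v₀ = (z.1 - u₀) * z.2 + u₀ * (z.2 - v₀) := by noncomm_ring
    simp only [e]
    exact (map_add_le_add r.1 _ _).trans (add_le_add (h _ _) (h _ _))
  continuous_neg := continuous_neg

/-- The complete projective tensor product of `⊗̂`-algebras is a `⊗̂`-algebra. -/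
instance : ProjAlgebra (CompletedTensor A B) where
  isUniformAddGroup := inferInstance
  polynormableSpace := Completion.instPolynormableSpace (E := ProjTensor A B)
  completeSpace := inferInstance
  t2Space := inferInstance
  isTopologicalRing := inferInstance

/-- The multiplication of a `⊗̂`-algebra as a continuous linear map on the complete projective
tensor product. -/
def CompletedTensor.mulMap : CompletedTensor A A →L[ℂ] A :=
  CompletedTensor.lift (LinearMap.mul ℂ A) (ProjAlgebra.exists_mul_bound A)

theorem CompletedTensor.mulMap_ctmul (a b : A) :
    CompletedTensor.mulMap A (ctmul a b) = a * b :=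
  CompletedTensor.lift_ctmul _ _ a b

theorem CompletedTensor.ctmul_mul_ctmul (a a' : A) (b b' : B) :
    (ctmul a b * ctmul a' b' : CompletedTensor A B) = ctmul (a * a') (b * b') :=
  (UniformSpace.Completion.coe_mul (α := ProjTensor A B) (toProj (a ⊗ₜ b))
    (toProj (a' ⊗ₜ b'))).symm.trans
    (congrArg UniformSpace.Completion.coe' (Algebra.TensorProduct.tmul_mul_tmul a a' b b'))

end TensorAlgebra

/-- An Arens–Michael algebra: a complete Hausdorff topological algebra whose topology is generated
by a family of submultiplicative seminorms. -/
class ArensMichaelAlgebra (A : Type*) [Ring A] [Algebra ℂ A] [UniformSpace A] : Prop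
    extends ProjAlgebra A where
  exists_submultiplicative : ∃ P : Set (Seminorm ℂ A),
    (∀ p ∈ P, ∀ a b, p (a * b) ≤ p a * p b) ∧
      WithSeminorms (fun p : P => (p : Seminorm ℂ A))

/-- `ι : A → Â` is an Arens–Michael envelope of the topological algebra `A`: every continuous
homomorphism from `A` to an Arens–Michael algebra factors uniquely through `ι`. -/
def IsArensMichaelEnvelope {A Â : Type u} [Ring A] [Algebra ℂ A] [TopologicalSpace A]
    [Ring Â] [Algebra ℂ Â] [UniformSpace Â] [ArensMichaelAlgebra Â] (ι : A →A[ℂ] Â) : Prop :=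
  ∀ (B : Type u) [Ring B] [Algebra ℂ B] [UniformSpace B] [ArensMichaelAlgebra B]
    (φ : A →A[ℂ] B), ∃! ψ : Â →A[ℂ] B, ψ.comp ι = φ

/-- The coefficient families of free entire functions in `n` variables: families indexed by words
with `∑ |c_w| ρ ^ |w| < ∞` for all `ρ > 0`. -/
def IsFreeEntire {n : ℕ} (c : FreeMonoid (Fin n) → ℂ) : Prop :=
  ∀ ρ : ℝ, 0 < ρ → Summable fun w => ‖c w‖ * ρ ^ w.length

/-- A holomorphically finitely generated algebra: a Fréchet Arens–Michael algebra with finitely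
many elements such that each element is a free entire function of them. -/
structure IsHFG (A : Type*) [Ring A] [Algebra ℂ A] [UniformSpace A] [ArensMichaelAlgebra A] :
    Prop where
  metrizable : TopologicalSpace.MetrizableSpace A
  exists_generators : ∃ (n : ℕ) (x : Fin n → A), ∀ a : A,
    ∃ c : FreeMonoid (Fin n) → ℂ, IsFreeEntire c ∧ HasSum (fun w => c w • FreeMonoid.lift x w) a

/-! ### Hopf `⊗̂`-algebras -/

/-- A Hopf `⊗̂`-algebra structure on a `⊗̂`-algebra `A`: a comultiplication and a counit, which are
continuous homomorphisms, and an antipode, which is a continuous linear map. -/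
structure HopfProjAlgebra (A : Type*) [Ring A] [Algebra ℂ A] [UniformSpace A]
    [ProjAlgebra A] where
  /-- The comultiplication. -/
  comul : A →A[ℂ] CompletedTensor A A
  /-- The counit. -/
  counit : A →A[ℂ] ℂ
  /-- The antipode. -/
  antipode : A →L[ℂ] A
  coassoc : ∀ a, CompletedTensor.assoc A A A
      (CompletedTensor.map comul.toContinuousLinearMap (ContinuousLinearMap.id ℂ A) (comul a)) =
    CompletedTensor.map (ContinuousLinearMap.id ℂ A) comul.toContinuousLinearMap (comul a)
  counit_comul_left : ∀ a, CompletedTensor.map counit.toContinuousLinearMap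
    (ContinuousLinearMap.id ℂ A) (comul a) = ctmul (1 : ℂ) a
  counit_comul_right : ∀ a, CompletedTensor.map (ContinuousLinearMap.id ℂ A)
    counit.toContinuousLinearMap (comul a) = ctmul a (1 : ℂ)
  antipode_left : ∀ a, CompletedTensor.mulMap A
    (CompletedTensor.map antipode (ContinuousLinearMap.id ℂ A) (comul a)) =
      algebraMap ℂ A (counit a)
  antipode_right : ∀ a, CompletedTensor.mulMap A
    (CompletedTensor.map (ContinuousLinearMap.id ℂ A) antipode (comul a)) =
      algebraMap ℂ A (counit a)

/-- A continuous homomorphism of algebras is a homomorphism of Hopf `⊗̂`-algebras if it is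
compatible with the comultiplications, the counits and the antipodes. -/
structure IsHopfHom {A B : Type*} [Ring A] [Algebra ℂ A] [UniformSpace A] [ProjAlgebra A]
    [Ring B] [Algebra ℂ B] [UniformSpace B] [ProjAlgebra B]
    (SA : HopfProjAlgebra A) (SB : HopfProjAlgebra B) (f : A →A[ℂ] B) : Prop where
  comul : ∀ a, SB.comul (f a) =
    CompletedTensor.map f.toContinuousLinearMap f.toContinuousLinearMap (SA.comul a)
  counit : ∀ a, SB.counit (f a) = SA.counit a
  antipode : ∀ a, SB.antipode (f a) = f (SA.antipode a)

/-! ### The strongest locally convex topology -/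

/-- The vector space `H`, to be endowed with its strongest locally convex topology. -/
def FinestLC (H : Type u) : Type u := H

section FinestLC

variable (H : Type u) [Ring H]

instance : Ring (FinestLC H) := inferInstanceAs (Ring H)

instance [Algebra ℂ H] : Algebra ℂ (FinestLC H) := inferInstanceAs (Algebra ℂ H)

/-- The strongest locally convex topology: the one generated by all seminorms. -/
instance [Algebra ℂ H] : UniformSpace (FinestLC H) :=
  seminormUniformSpace (fun p : Seminorm ℂ (FinestLC H) => p)

end FinestLC

/-- A Hopf `⊗̂`-algebra structure on `H` with the strongest locally convex topology is the one
given by the Hopf algebra `H` if its comultiplication (composed with the canonical map from the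
algebraic tensor square to the completed one), counit and antipode are those of `H`. -/
structure IsInducedByHopf {H : Type u} [Ring H] [HopfAlgebra ℂ H] [ProjAlgebra (FinestLC H)]
    (S : HopfProjAlgebra (FinestLC H)) : Prop where
  comul : ∀ h : H, S.comul (h : FinestLC H) =
    CompletedTensor.ofTensor (E := FinestLC H) (F := FinestLC H)
      (CoalgebraStruct.comul (R := ℂ) h : H ⊗[ℂ] H)
  counit : ∀ h : H, S.counit (h : FinestLC H) = CoalgebraStruct.counit (R := ℂ) h
  antipode : ∀ h : H, S.antipode (h : FinestLC H) = (HopfAlgebraStruct.antipode ℂ h : H)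

end

/-!
The proof rests on two descriptions of topologies. The strongest locally convex topology of `H` is
given by the weighted `ℓ¹` seminorms in a basis: this makes it complete, and, since a finitely
generated algebra has countable dimension, every bilinear map on it is jointly continuous, because
a function of two natural numbers is dominated by a product `a m * a n`
(`FinestLC.instProjAlgebra`). All linear maps out of it are continuous, so the Hopf algebra
structure of `H` is a Hopf `⊗̂`-algebra structure (`FinestLC.hopfProjAlgebra`).

An Arens–Michael envelope is the completion of `H` for all submultiplicative seminorms
(`SubmultTop.isArensMichaelEnvelope`). If `H` is spanned by the words `x_w` in finitely many
elements, these seminorms are dominated by the quotient norms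
`h ↦ inf {∑ |c_w| k ^ |w| | h = ∑ c_w x_w}` with `k = 1, 2, …`. Hence the envelope is metrizable,
and approximating an element of it by a sequence in `H` whose consecutive differences have small
representations yields an expansion `∑ c_w x_w` with `∑ |c_w| ρ ^ |w| < ∞` for all `ρ`
(`exists_hasSum_of_spanSeminorm`, `SubmultTop.isHFG`). Any other envelope is isomorphic to this
one.

The complete projective tensor product of Arens–Michael algebras, the field `ℂ` and the opposite of
an Arens–Michael algebra are Arens–Michael algebras. So the comultiplication, the counit and the
antipode of `H`, a homomorphism to the opposite algebra, all extend to an envelope by its universal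
property. The Hopf identities hold there because they hold on the dense image of `H`
(`HopfProjAlgebra.exists_of_envelope`).
-/

noncomputable section

/-! ### Locally multiplicatively convex algebras -/

section LocallyMConvex

open UniformSpace

/-- A topological algebra is locally multiplicatively convex if its continuous seminorms are
dominated, up to constants, by continuous submultiplicative ones. The multiplication is not assumed
to be continuous, so that the notion applies before this is known. -/
def IsLocallyMConvex (A : Type*) [Ring A] [Algebra ℂ A] [TopologicalSpace A] : Prop :=
  ∀ r : Seminorm ℂ A, Continuous r → ∃ p : Seminorm ℂ A, Continuous p ∧
    (∀ a b, p (a * b) ≤ p a * p b) ∧ ∃ C : ℝ, 0 ≤ C ∧ ∀ a, r a ≤ C * p a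

theorem IsLocallyMConvex.of_withSeminorms {A ι : Type*} [Ring A] [Algebra ℂ A]
    [TopologicalSpace A] {P : SeminormFamily ℂ A ι} (hP : WithSeminorms P)
    (hmul : ∀ i a b, P i (a * b) ≤ P i a * P i b) : IsLocallyMConvex A := by
  intro r hr
  have := hP.topologicalAddGroup
  obtain ⟨s, C, -, hC⟩ := Seminorm.bound_of_continuous hP r hr
  refine ⟨s.sup P, Seminorm.continuous_finsetSup fun i _ => hP.continuous_seminorm i,
    fun a b => ?_, C, C.2, hC⟩
  refine Seminorm.finset_sup_apply_le (mul_nonneg (apply_nonneg _ _) (apply_nonneg _ _))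
    fun i hi => (hmul i a b).trans ?_
  exact mul_le_mul (Seminorm.le_finset_sup_apply hi) (Seminorm.le_finset_sup_apply hi)
    (apply_nonneg _ _) (apply_nonneg _ _)

theorem ArensMichaelAlgebra.isLocallyMConvex (A : Type*) [Ring A] [Algebra ℂ A] [UniformSpace A]
    [ArensMichaelAlgebra A] : IsLocallyMConvex A := by
  obtain ⟨P, hP, hW⟩ := ArensMichaelAlgebra.exists_submultiplicative (A := A)
  exact .of_withSeminorms hW fun p => hP p p.2

theorem IsLocallyMConvex.arensMichaelAlgebra {A : Type*} [Ring A] [Algebra ℂ A] [UniformSpace A]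
    [ProjAlgebra A] (h : IsLocallyMConvex A) : ArensMichaelAlgebra A where
  exists_submultiplicative := by
    refine ⟨{p | Continuous p ∧ ∀ a b, p (a * b) ≤ p a * p b}, fun p hp => hp.2, ?_⟩
    refine (PolynormableSpace.withSeminorms ℂ A).congr (fun p => ?_) fun r => ?_
    · exact ⟨{⟨p.1, p.2.1⟩}, 1, fun a => by simp⟩
    · obtain ⟨p, hp, hmul, C, hC, hle⟩ := h r.1 r.2
      exact ⟨{⟨p, hp, hmul⟩}, ⟨C, hC⟩, fun a => by simpa using! hle a⟩

/-- The canonical homomorphism from a topological algebra to its completion. -/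
def Completion.coeAlgHom (E : Type*) [Ring E] [Algebra ℂ E] [UniformSpace E]
    [IsUniformAddGroup E] [UniformContinuousConstSMul ℂ E] [IsTopologicalRing E] :
    E →A[ℂ] Completion E :=
  { (Completion.coeRingHom : E →+* Completion E) with
    commutes' := fun _ => rfl
    cont := Completion.continuous_coe E }

theorem IsLocallyMConvex.completion {E : Type*} [Ring E] [Algebra ℂ E] [UniformSpace E]
    [IsUniformAddGroup E] [UniformContinuousConstSMul ℂ E] [IsTopologicalRing E]
    (h : IsLocallyMConvex E) : IsLocallyMConvex (Completion E) := by
  intro r hr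
  obtain ⟨p, hp, hmul, C, hC, hle⟩ := h
    (r.comp (Completion.coeAlgHom E).toContinuousLinearMap.toLinearMap)
    (hr.comp (Completion.continuous_coe E))
  have hpc := Seminorm.continuous_completionExtension p hp
  refine ⟨p.completionExtension hp, hpc, fun a b => ?_, C, hC, fun a => ?_⟩
  · refine Completion.induction_on₂ a b (isClosed_le ?_ ?_) fun a b => ?_
    · exact hpc.comp continuous_mul
    · exact (hpc.comp continuous_fst).mul (hpc.comp continuous_snd)
    · rw [← Completion.coe_mul]
      simp only [Seminorm.completionExtension_coe]
      exact hmul a b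
  · refine Completion.induction_on a (isClosed_le hr (continuous_const.mul hpc)) fun a => ?_
    rw [Seminorm.completionExtension_coe]
    exact hle a

theorem Completion.projAlgebra (E : Type*) [Ring E] [Algebra ℂ E] [UniformSpace E]
    [IsUniformAddGroup E] [UniformContinuousConstSMul ℂ E] [IsTopologicalRing E]
    [PolynormableSpace ℂ E] : ProjAlgebra (Completion E) where
  isUniformAddGroup := inferInstance
  polynormableSpace := Completion.instPolynormableSpace
  completeSpace := inferInstance
  t2Space := inferInstance
  isTopologicalRing := inferInstance

theorem projSeminorm_mul_le {A B : Type*} [Ring A] [Algebra ℂ A] [Ring B] [Algebra ℂ B]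
    {p : Seminorm ℂ A} {q : Seminorm ℂ B} (hp : ∀ a b, p (a * b) ≤ p a * p b)
    (hq : ∀ a b, q (a * b) ≤ q a * q b) (u v : A ⊗[ℂ] B) :
    projSeminorm p q (u * v) ≤ projSeminorm p q u * projSeminorm p q v := by
  have step : ∀ (a : A) (b : B) (v : A ⊗[ℂ] B),
      projSeminorm p q ((a ⊗ₜ b) * v) ≤ p a * q b * projSeminorm p q v := fun a b v =>
    le_projSeminorm p q ((projSeminorm p q).comp (LinearMap.mulLeft ℂ (a ⊗ₜ[ℂ] b : A ⊗[ℂ] B)))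
      (mul_nonneg (apply_nonneg _ _) (apply_nonneg _ _))
      (fun c d => by
        have e : (projSeminorm p q).comp (LinearMap.mulLeft ℂ (a ⊗ₜ[ℂ] b : A ⊗[ℂ] B)) (c ⊗ₜ d)
            = projSeminorm p q ((a * c) ⊗ₜ (b * d)) := by simp
        rw [e]
        calc projSeminorm p q ((a * c) ⊗ₜ (b * d)) ≤ p (a * c) * q (b * d) :=
              projSeminorm_tmul_le _ _ _ _
          _ ≤ (p a * p c) * (q b * q d) :=
              mul_le_mul (hp a c) (hq b d) (apply_nonneg _ _)
                (mul_nonneg (apply_nonneg _ _) (apply_nonneg _ _))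
          _ = p a * q b * (p c * q d) := by ring) v
  have := le_projSeminorm p q ((projSeminorm p q).comp (LinearMap.mulRight ℂ (v : A ⊗[ℂ] B)))
    (apply_nonneg (projSeminorm p q) v)
    (fun a b => by rw [mul_comm]; exact step a b v) u
  rw [mul_comm] at this
  exact this

theorem ProjTensor.isLocallyMConvex (A B : Type*) [Ring A] [Algebra ℂ A] [UniformSpace A]
    [ArensMichaelAlgebra A] [Ring B] [Algebra ℂ B] [UniformSpace B] [ArensMichaelAlgebra B] :
    IsLocallyMConvex (ProjTensor A B) := by
  intro r hr
  obtain ⟨p, hp, q, hq, h⟩ := ProjTensor.exists_bound r hr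
  obtain ⟨p', hp', hpm, C, hC, hpC⟩ := ArensMichaelAlgebra.isLocallyMConvex A p hp
  obtain ⟨q', hq', hqm, D, hD, hqD⟩ := ArensMichaelAlgebra.isLocallyMConvex B q hq
  refine ⟨ProjTensor.seminorm p' q', ProjTensor.continuous_seminorm p' hp' q' hq',
    projSeminorm_mul_le hpm hqm, C * D, mul_nonneg hC hD, fun u => ?_⟩
  refine le_projSeminorm p' q' (r.comp toProj.toLinearMap) (mul_nonneg hC hD) (fun x y => ?_) u
  calc r (toProj (x ⊗ₜ y)) ≤ p x * q y := h x y
    _ ≤ (C * p' x) * (D * q' y) :=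
        mul_le_mul (hpC x) (hqD y) (apply_nonneg _ _) (mul_nonneg hC (apply_nonneg _ _))
    _ = C * D * (p' x * q' y) := by ring

/-- The complete projective tensor product of Arens–Michael algebras is Arens–Michael. -/
instance CompletedTensor.instArensMichaelAlgebra (A B : Type*) [Ring A] [Algebra ℂ A]
    [UniformSpace A] [ArensMichaelAlgebra A] [Ring B] [Algebra ℂ B] [UniformSpace B]
    [ArensMichaelAlgebra B] : ArensMichaelAlgebra (CompletedTensor A B) :=
  (ProjTensor.isLocallyMConvex A B).completion.arensMichaelAlgebra

instance Complex.instProjAlgebra : ProjAlgebra ℂ where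
  isUniformAddGroup := inferInstance
  polynormableSpace := inferInstance
  completeSpace := inferInstance
  t2Space := inferInstance
  isTopologicalRing := inferInstance

instance Complex.instArensMichaelAlgebra : ArensMichaelAlgebra ℂ :=
  (IsLocallyMConvex.of_withSeminorms (norm_withSeminorms ℂ ℂ)
    fun _ a b => (norm_mul a b).le).arensMichaelAlgebra

instance MulOpposite.instProjAlgebra (A : Type*) [Ring A] [Algebra ℂ A] [UniformSpace A]
    [ProjAlgebra A] : ProjAlgebra Aᵐᵒᵖ where
  isUniformAddGroup :=
    { uniformContinuous_sub := MulOpposite.uniformContinuous_op.comp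
        (uniformContinuous_sub.comp (MulOpposite.uniformContinuous_unop.prodMap
          MulOpposite.uniformContinuous_unop)) }
  polynormableSpace := Topology.IsInducing.polynormableSpace (𝕜₂ := ℂ)
    (f := (MulOpposite.opLinearEquiv ℂ : A ≃ₗ[ℂ] Aᵐᵒᵖ).symm.toLinearMap)
    MulOpposite.opHomeomorph.symm.isInducing
  completeSpace := inferInstance
  t2Space := inferInstance
  isTopologicalRing := inferInstance

/-- The opposite of an Arens–Michael algebra is Arens–Michael. -/
instance MulOpposite.instArensMichaelAlgebra (A : Type*) [Ring A] [Algebra ℂ A] [UniformSpace A]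
    [ArensMichaelAlgebra A] : ArensMichaelAlgebra Aᵐᵒᵖ := by
  refine IsLocallyMConvex.arensMichaelAlgebra fun r hr => ?_
  obtain ⟨p, hp, hmul, C, hC, h⟩ := ArensMichaelAlgebra.isLocallyMConvex A
    (r.comp (MulOpposite.opLinearEquiv ℂ : A ≃ₗ[ℂ] Aᵐᵒᵖ).toLinearMap)
    (hr.comp MulOpposite.continuous_op)
  refine ⟨p.comp (MulOpposite.opLinearEquiv ℂ : A ≃ₗ[ℂ] Aᵐᵒᵖ).symm.toLinearMap,
    hp.comp MulOpposite.continuous_unop, fun a b => ?_, C, hC, fun a => h a.unop⟩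
  exact (hmul b.unop a.unop).trans_eq (mul_comm _ _)

end LocallyMConvex

/-! ### Weighted `ℓ¹` seminorms -/

section Weighted

open Finsupp

variable {ι V : Type*} [AddCommGroup V] [Module ℂ V]

theorem summable_weight_mul_norm (a : ι → NNReal) (c : ι →₀ ℂ) :
    Summable fun i => (a i : ℝ) * ‖c i‖ :=
  summable_of_hasFiniteSupport (c.hasFiniteSupport.subset fun i hi => by
    contrapose! hi
    simp_all)

/-- The weighted `ℓ¹` seminorm `c ↦ ∑ aᵢ |cᵢ|` on finitely supported families. -/
def weightedSeminorm (a : ι → NNReal) : Seminorm ℂ (ι →₀ ℂ) :=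
  Seminorm.of (fun c => ∑' i, (a i : ℝ) * ‖c i‖)
    (fun c d => by
      rw [← (summable_weight_mul_norm a c).tsum_add (summable_weight_mul_norm a d)]
      refine (summable_weight_mul_norm a (c + d)).tsum_le_tsum (fun i => ?_)
        ((summable_weight_mul_norm a c).add (summable_weight_mul_norm a d))
      rw [← mul_add]
      exact mul_le_mul_of_nonneg_left (norm_add_le _ _) (a i).2)
    (fun z c => by
      rw [← tsum_mul_left]
      refine tsum_congr fun i => ?_
      rw [Finsupp.smul_apply, norm_smul]
      ring)

theorem sum_le_weightedSeminorm (a : ι → NNReal) (c : ι →₀ ℂ) (J : Finset ι) :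
    ∑ i ∈ J, (a i : ℝ) * ‖c i‖ ≤ weightedSeminorm a c :=
  (summable_weight_mul_norm a c).sum_le_tsum J
    fun i _ => mul_nonneg (a i).2 (norm_nonneg _)

theorem weightedSeminorm_eq_sum (a : ι → NNReal) (c : ι →₀ ℂ) (J : Finset ι)
    (hJ : c.support ⊆ J) : weightedSeminorm a c = ∑ i ∈ J, (a i : ℝ) * ‖c i‖ :=
  tsum_eq_sum fun i hi => by
    have : c i = 0 := by
      by_contra h
      exact hi (hJ (Finsupp.mem_support_iff.2 h))
    simp [this]

theorem weightedSeminorm_single (a : ι → NNReal) (i : ι) (z : ℂ) :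
    weightedSeminorm a (single i z) = a i * ‖z‖ := by
  rw [weightedSeminorm_eq_sum a (single i z) {i} Finsupp.support_single_subset]
  simp

/-- A linear map out of the finitely supported families is bounded for a weighted `ℓ¹` seminorm as
soon as it is bounded on the unit vectors. -/
theorem le_weightedSeminorm (v : ι → V) (s : Seminorm ℂ V) (a : ι → NNReal) (C : ℝ)
    (h : ∀ i, s (v i) ≤ C * a i) (c : ι →₀ ℂ) :
    s (linearCombination ℂ v c) ≤ C * weightedSeminorm a c := by
  rw [weightedSeminorm_eq_sum a c _ subset_rfl, linearCombination_apply, Finsupp.sum,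
    Finset.mul_sum]
  refine (Finset.le_sum_of_subadditive s (map_zero s).le (map_add_le_add s) _ _).trans
    (Finset.sum_le_sum fun i _ => ?_)
  rw [map_smul_eq_mul]
  calc ‖c i‖ * s (v i) ≤ ‖c i‖ * (C * a i) := mul_le_mul_of_nonneg_left (h i) (norm_nonneg _)
    _ = C * (a i * ‖c i‖) := by ring

theorem spanSeminorm_costs_nonempty {v : ι → V} (hv : ⊤ ≤ Submodule.span ℂ (Set.range v))
    (a : ι → NNReal) (x : V) :
    (weightedSeminorm a '' {c | linearCombination ℂ v c = x}).Nonempty := by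
  obtain ⟨c, hc⟩ := (Finsupp.mem_span_range_iff_exists_finsupp).1 (hv (Submodule.mem_top (x := x)))
  exact ⟨_, c, hc, rfl⟩

theorem spanSeminorm_costs_bddBelow (v : ι → V) (a : ι → NNReal) (x : V) :
    BddBelow (weightedSeminorm a '' {c | linearCombination ℂ v c = x}) :=
  ⟨0, by rintro _ ⟨c, -, rfl⟩; exact apply_nonneg _ _⟩

/-- The quotient of a weighted `ℓ¹` seminorm along a spanning family `v`: the infimum of the costs
`∑ aᵢ |cᵢ|` of all representations `x = ∑ cᵢ vᵢ`. -/
def spanSeminorm (v : ι → V) (hv : ⊤ ≤ Submodule.span ℂ (Set.range v)) (a : ι → NNReal) :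
    Seminorm ℂ V :=
  Seminorm.ofSMulLE (fun x => sInf (weightedSeminorm a '' {c | linearCombination ℂ v c = x}))
    (le_antisymm (csInf_le (spanSeminorm_costs_bddBelow v a 0) ⟨0, by simp, by simp⟩)
      (le_csInf (spanSeminorm_costs_nonempty hv a 0)
        (by rintro _ ⟨c, -, rfl⟩; exact apply_nonneg _ _)))
    (fun x y => by
      refine le_of_forall_pos_le_add fun ε hε => ?_
      obtain ⟨_, ⟨c, hc, rfl⟩, hcε⟩ :=
        exists_lt_of_csInf_lt (spanSeminorm_costs_nonempty hv a x)
          (lt_add_of_pos_right _ (half_pos hε))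
      obtain ⟨_, ⟨d, hd, rfl⟩, hdε⟩ :=
        exists_lt_of_csInf_lt (spanSeminorm_costs_nonempty hv a y)
          (lt_add_of_pos_right _ (half_pos hε))
      have hc : linearCombination ℂ v c = x := hc
      have hd : linearCombination ℂ v d = y := hd
      refine (csInf_le (spanSeminorm_costs_bddBelow v a (x + y))
        ⟨c + d, by rw [Set.mem_ofPred_eq, map_add, hc, hd], rfl⟩).trans ?_
      have := map_add_le_add (weightedSeminorm a) c d
      linarith)
    (fun z x => by
      rcases eq_or_ne z 0 with rfl | hz
      · rw [zero_smul, norm_zero, zero_mul]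
        exact csInf_le (spanSeminorm_costs_bddBelow v a 0) ⟨0, by simp, by simp⟩
      · have hz' : 0 < ‖z‖ := norm_pos_iff.2 hz
        rw [← div_le_iff₀' hz']
        refine le_csInf (spanSeminorm_costs_nonempty hv a x) ?_
        rintro _ ⟨c, hc, rfl⟩
        have hc : linearCombination ℂ v c = x := hc
        rw [div_le_iff₀' hz', ← map_smul_eq_mul]
        exact csInf_le (spanSeminorm_costs_bddBelow v a _)
          ⟨z • c, by rw [Set.mem_ofPred_eq, map_smul, hc], rfl⟩)

section

variable {v : ι → V} (hv : ⊤ ≤ Submodule.span ℂ (Set.range v))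

theorem spanSeminorm_linearCombination_le (a : ι → NNReal) (c : ι →₀ ℂ) :
    spanSeminorm v hv a (linearCombination ℂ v c) ≤ weightedSeminorm a c :=
  csInf_le (spanSeminorm_costs_bddBelow v a _) ⟨c, rfl, rfl⟩

theorem spanSeminorm_le (a : ι → NNReal) (i : ι) : spanSeminorm v hv a (v i) ≤ a i := by
  simpa [weightedSeminorm_single] using
    spanSeminorm_linearCombination_le hv a (single i 1)

theorem exists_weightedSeminorm_lt {a : ι → NNReal} {x : V} {r : ℝ}
    (h : spanSeminorm v hv a x < r) :
    ∃ c, linearCombination ℂ v c = x ∧ weightedSeminorm a c < r := by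
  obtain ⟨_, ⟨c, hc, rfl⟩, hr⟩ :=
    exists_lt_of_csInf_lt (spanSeminorm_costs_nonempty hv a x) h
  exact ⟨c, hc, hr⟩

/-- Up to constants, `spanSeminorm v hv a` is the largest seminorm that is at most `a i` at every
`v i`. -/
theorem le_spanSeminorm (s : Seminorm ℂ V) (a : ι → NNReal) {C : ℝ} (hC : 0 ≤ C)
    (h : ∀ i, s (v i) ≤ C * a i) (x : V) : s x ≤ C * spanSeminorm v hv a x := by
  refine le_of_forall_pos_le_add fun ε hε => ?_
  obtain ⟨c, rfl, hc⟩ := exists_weightedSeminorm_lt hv (a := a) (x := x)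
    (lt_add_of_pos_right _ (div_pos hε (lt_add_of_le_of_pos hC one_pos)))
  have h1 := le_weightedSeminorm v s a C h c
  have h2 : C * (ε / (C + 1)) ≤ ε := by
    rw [← mul_div_assoc, div_le_iff₀ (by linarith)]
    nlinarith
  nlinarith [mul_le_mul_of_nonneg_left hc.le hC]

end

end Weighted

/-! ### The strongest locally convex topology -/

section Bilinear

theorem isTopologicalRing_of_exists_mul_bound {A : Type*} [Ring A] [Algebra ℂ A]
    [TopologicalSpace A] [PolynormableSpace ℂ A]
    (h : ∀ r : Seminorm ℂ A, Continuous r → ∃ p : Seminorm ℂ A, Continuous p ∧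
      ∃ q : Seminorm ℂ A, Continuous q ∧ ∀ u v, r (u * v) ≤ p u * q v) :
    IsTopologicalRing A := by
  have hA := PolynormableSpace.withSeminorms ℂ A
  have := hA.topologicalAddGroup
  refine { continuous_mul := ?_, continuous_neg := continuous_neg }
  rw [continuous_iff_continuousAt]
  rintro ⟨u₀, v₀⟩
  refine (hA.tendsto_nhds _ _).2 fun r ε hε => ?_
  obtain ⟨p, hp, q, hq, h⟩ := h r.1 r.2
  have hlim : Filter.Tendsto
      (fun z : A × A => p (z.1 - u₀) * q z.2 + p u₀ * q (z.2 - v₀)) (𝓝 (u₀, v₀)) (𝓝 0) := by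
    have hc : Continuous fun z : A × A =>
        p (z.1 - u₀) * q z.2 + p u₀ * q (z.2 - v₀) := by fun_prop
    simpa using hc.tendsto (u₀, v₀)
  filter_upwards [hlim.eventually_lt_const hε] with z hz
  refine lt_of_le_of_lt ?_ hz
  have e : z.1 * z.2 - u₀ * v₀ = (z.1 - u₀) * z.2 + u₀ * (z.2 - v₀) := by noncomm_ring
  simp only [e]
  exact (map_add_le_add r.1 _ _).trans (add_le_add (h _ _) (h _ _))

/-- Every function of two natural numbers is dominated by a product of functions of one variable;
this is what makes bilinear maps on spaces of countable dimension jointly continuous. -/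
theorem exists_nnreal_le_mul (g : ℕ → ℕ → NNReal) : ∃ a : ℕ → NNReal, ∀ m n, g m n ≤ a m * a n := by
  let a : ℕ → NNReal := fun m => 1 + ∑ i ∈ Finset.range (m + 1), ∑ j ∈ Finset.range (m + 1), g i j
  have h1 : ∀ m, 1 ≤ a m := fun m => le_self_add
  have h2 : ∀ m n k, m ≤ k → n ≤ k → g m n ≤ a k := fun m n k hm hn => by
    refine le_add_left ((Finset.single_le_sum (f := fun j => g m j) (fun _ _ => zero_le)
      (Finset.mem_range.2 (Nat.lt_succ_of_le hn))).trans ?_)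
    exact Finset.single_le_sum (f := fun i => ∑ j ∈ Finset.range (k + 1), g i j)
      (fun _ _ => zero_le) (Finset.mem_range.2 (Nat.lt_succ_of_le hm))
  refine ⟨a, fun m n => ?_⟩
  rcases le_total m n with h | h
  · exact (h2 m n n h le_rfl).trans (le_mul_of_one_le_left' (h1 m))
  · exact (h2 m n m le_rfl h).trans (le_mul_of_one_le_right' (h1 n))

end Bilinear

section FinestLC

variable (H : Type u) [Ring H] [Algebra ℂ H]

namespace FinestLC

theorem withSeminorms : WithSeminorms (fun p : Seminorm ℂ (FinestLC H) => p) :=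
  seminormUniformSpace_withSeminorms _

instance : IsUniformAddGroup (FinestLC H) :=
  seminormUniformSpace_isUniformAddGroup _

instance : PolynormableSpace ℂ (FinestLC H) :=
  (withSeminorms H).toPolynormableSpace

variable {H}

theorem continuous_seminorm (p : Seminorm ℂ (FinestLC H)) : Continuous p :=
  (withSeminorms H).continuous_seminorm p

theorem continuous_linearMap {G : Type*} [AddCommGroup G] [Module ℂ G] [TopologicalSpace G]
    [PolynormableSpace ℂ G] (f : FinestLC H →ₗ[ℂ] G) : Continuous f :=
  (PolynormableSpace.withSeminorms ℂ G).continuous_of_continuous_comp f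
    fun p => continuous_seminorm (p.1.comp f)

/-- The weighted `ℓ¹` seminorm in the coordinates of a basis. -/
def basisSeminorm {ι : Type*} (b : Module.Basis ι ℂ (FinestLC H)) (a : ι → NNReal) :
    Seminorm ℂ (FinestLC H) :=
  (weightedSeminorm a).comp b.repr.toLinearMap

theorem le_basisSeminorm {ι : Type*} (b : Module.Basis ι ℂ (FinestLC H)) (a : ι → NNReal)
    (s : Seminorm ℂ (FinestLC H)) {C : ℝ} (h : ∀ i, s (b i) ≤ C * a i) (x : FinestLC H) :
    s x ≤ C * basisSeminorm b a x := by
  have := le_weightedSeminorm b s a C h (b.repr x)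
  rwa [b.linearCombination_repr] at this

instance : T2Space (FinestLC H) := by
  have : T1Space (FinestLC H) := by
    refine (withSeminorms H).T1_of_separating fun x hx => ?_
    let b := Module.Basis.ofVectorSpace ℂ (FinestLC H)
    refine ⟨(normSeminorm ℂ ℂ).comp (b.coord (b.repr.map_ne_zero_iff.2 hx |>
      fun h => (Finsupp.support_nonempty_iff.2 h).choose)), ?_⟩
    have := (Finsupp.support_nonempty_iff.2 (b.repr.map_ne_zero_iff.2 hx)).choose_spec
    simpa using this
  infer_instance

theorem exists_sub_lt_of_cauchy {f : Filter (FinestLC H)} (hf : Cauchy f)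
    (p : Seminorm ℂ (FinestLC H)) {ε : ℝ} (hε : 0 < ε) :
    ∃ S ∈ f, ∀ x ∈ S, ∀ y ∈ S, p (x - y) < ε := by
  have hU : {z : FinestLC H × FinestLC H | p (z.1 - z.2) < ε} ∈ uniformity (FinestLC H) := by
    rw [uniformity_eq_comap_nhds_zero_swapped]
    refine ⟨{x | p x < ε}, ?_, subset_rfl⟩
    exact (continuous_seminorm p).continuousAt.eventually_lt_const (by simpa using hε)
  obtain ⟨S, hS, h⟩ := (cauchy_iff.1 hf).2 _ hU
  exact ⟨S, hS, fun x hx y hy => h (Set.mk_mem_prod hx hy)⟩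

/-- The strongest locally convex topology is complete. The coordinates of a Cauchy filter in a
basis converge to a family `x`; an infinite support of `x` is excluded by a weighted `ℓ¹` seminorm
whose weights grow on it, and convergence holds for each weighted `ℓ¹` seminorm, by passing to the
limit in one variable of the Cauchy condition. -/
instance : CompleteSpace (FinestLC H) where
  complete := by
    intro f hf
    have := hf.1
    let b := Module.Basis.ofVectorSpace ℂ (FinestLC H)
    have hlim : ∀ i, ∃ z, Filter.Tendsto (fun h => b.repr h i) f (𝓝 z) := fun i => by
      let φ : FinestLC H →L[ℂ] ℂ := ⟨b.coord i, continuous_linearMap _⟩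
      exact cauchy_map_iff_exists_tendsto.1 (hf.map φ.uniformContinuous)
    choose x hx using hlim
    -- If the support contained distinct indices `e 0, e 1, …`, then the weights `n / |x (e n)|`
    -- would give a seminorm in which the elements of `f` are not eventually bounded.
    have hfin : (Function.support x).Finite := by
      by_contra hinf
      have := Set.infinite_coe_iff.2 hinf
      let e : ℕ → Module.Basis.ofVectorSpaceIndex ℂ (FinestLC H) :=
        fun n => (Infinite.natEmbedding (Function.support x) n).1
      have he : Function.Injective e :=
        Subtype.val_injective.comp (Infinite.natEmbedding (Function.support x)).injective
      let a : Module.Basis.ofVectorSpaceIndex ℂ (FinestLC H) → NNReal :=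
        fun i => (Function.invFun e i : ℕ) / ‖x i‖₊
      obtain ⟨S, hS, hd⟩ := exists_sub_lt_of_cauchy hf (basisSeminorm b a) one_pos
      obtain ⟨y₀, hy₀⟩ := Filter.nonempty_of_mem hS
      have hM : ∀ i, (a i : ℝ) * ‖x i‖ ≤ basisSeminorm b a y₀ + 1 := fun i => by
        refine le_of_tendsto ((hx i).norm.const_mul (a i : ℝ)) (Filter.mem_of_superset hS ?_)
        intro y hy
        have h1 : (a i : ℝ) * ‖b.repr y i‖ ≤ basisSeminorm b a y := by
          simpa using! sum_le_weightedSeminorm a (b.repr y) {i}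
        have h2 := map_add_le_add (basisSeminorm b a) y₀ (y - y₀)
        rw [add_sub_cancel] at h2
        have := hd y hy y₀ hy₀
        exact h1.trans (h2.trans (by linarith))
      obtain ⟨n, hn⟩ := exists_nat_gt (basisSeminorm b a y₀ + 1)
      have h := hM (e n)
      have h0 : ‖x (e n)‖ ≠ 0 := norm_ne_zero_iff.2 (Infinite.natEmbedding (Function.support x) n).2
      have : (a (e n) : ℝ) * ‖x (e n)‖ = n := by
        simp only [a, Function.leftInverse_invFun he n, NNReal.coe_div, NNReal.coe_natCast,
          coe_nnnorm, div_mul_cancel₀ _ h0]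
      linarith
    -- A seminorm `p` is dominated by the weighted `ℓ¹` seminorm with the weights `p (b i)`.
    refine ⟨b.repr.symm (Finsupp.ofSupportFinite x hfin),
      ((withSeminorms H).tendsto_nhds id _).2 fun p ε hε => ?_⟩
    let a : Module.Basis.ofVectorSpaceIndex ℂ (FinestLC H) → NNReal :=
      fun i => ⟨p (b i), apply_nonneg p _⟩
    obtain ⟨S, hS, hd⟩ := exists_sub_lt_of_cauchy hf (basisSeminorm b a) (half_pos hε)
    filter_upwards [hS] with y hy
    have h1 : p (y - b.repr.symm (Finsupp.ofSupportFinite x hfin)) ≤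
        1 * basisSeminorm b a (y - b.repr.symm (Finsupp.ofSupportFinite x hfin)) :=
      le_basisSeminorm b a p (fun i => (one_mul _).ge) _
    refine lt_of_le_of_lt (h1.trans ?_) (half_lt_self hε)
    rw [one_mul]
    change weightedSeminorm a (b.repr (y - b.repr.symm (Finsupp.ofSupportFinite x hfin))) ≤ _
    rw [map_sub, LinearEquiv.apply_symm_apply, weightedSeminorm_eq_sum a _ _ subset_rfl]
    have ht := tendsto_finsetSum
      ((b.repr y - Finsupp.ofSupportFinite x hfin).support)
      fun i _ => ((hx i).const_sub (b.repr y i)).norm.const_mul (a i : ℝ)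
    refine le_of_tendsto ht (Filter.mem_of_superset hS fun z hz => ?_)
    refine le_trans ?_ (hd y hy z hz).le
    refine le_trans (le_of_eq ?_) (sum_le_weightedSeminorm a (b.repr (y - z))
      ((b.repr y - Finsupp.ofSupportFinite x hfin).support))
    simp

/-- In countable dimension the multiplication is jointly continuous: the values of `r` on the
products of basis vectors are dominated by products of weights, which define `p = q`. -/
theorem exists_mul_bound {ι : Type*} [Countable ι] (b : Module.Basis ι ℂ (FinestLC H))
    (r : Seminorm ℂ (FinestLC H)) : ∃ p : Seminorm ℂ (FinestLC H), Continuous p ∧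
      ∃ q : Seminorm ℂ (FinestLC H), Continuous q ∧ ∀ u v, r (u * v) ≤ p u * q v := by
  obtain ⟨e, he⟩ := exists_injective_nat ι
  let b' : ℕ → FinestLC H := Function.extend e b 0
  obtain ⟨a, ha⟩ := exists_nnreal_le_mul fun m n => ⟨r (b' m * b' n), apply_nonneg r _⟩
  refine ⟨basisSeminorm b (a ∘ e), continuous_seminorm _, basisSeminorm b (a ∘ e),
    continuous_seminorm _, fun u v => ?_⟩
  have h1 : ∀ i j, r (b i * b j) ≤ a (e i) * a (e j) := fun i j => by
    have : r (b' (e i) * b' (e j)) ≤ a (e i) * a (e j) := ha (e i) (e j)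
    simpa only [b', he.extend_apply] using this
  have h2 : ∀ i, r (b i * v) ≤ basisSeminorm b (a ∘ e) v * (a ∘ e) i := fun i => by
    rw [mul_comm]
    exact le_basisSeminorm b (a ∘ e) (r.comp (LinearMap.mulLeft ℂ (b i))) (h1 i) v
  rw [mul_comm]
  exact le_basisSeminorm b (a ∘ e) (r.comp (LinearMap.mulRight ℂ v)) h2 u

end FinestLC

/-- A finitely generated algebra is spanned by the words in finitely many elements. -/
theorem exists_span_words_eq_top [Algebra.FiniteType ℂ H] :
    ∃ (n : ℕ) (x : Fin n → H), ⊤ ≤ Submodule.span ℂ (Set.range (FreeMonoid.lift x)) := by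
  obtain ⟨s, hs⟩ := Algebra.FiniteType.out (R := ℂ) (A := H)
  refine ⟨s.card, fun i => s.equivFin.symm i, ?_⟩
  have hr : Set.range (fun i => (s.equivFin.symm i : H)) = s := by
    rw [Set.range_comp' Subtype.val, s.equivFin.symm.surjective.range_eq]
    simp
  rw [← MonoidHom.coe_mrange, FreeMonoid.mrange_lift, hr, ← Algebra.adjoin_eq_span, hs,
    Algebra.top_toSubmodule]

instance FinestLC.instProjAlgebra [Algebra.FiniteType ℂ H] : ProjAlgebra (FinestLC H) where
  isUniformAddGroup := inferInstance
  polynormableSpace := inferInstance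
  completeSpace := inferInstance
  t2Space := inferInstance
  isTopologicalRing := by
    obtain ⟨n, x, hx⟩ := exists_span_words_eq_top H
    let b := Module.Basis.ofVectorSpace ℂ (FinestLC H)
    have : Countable (Module.Basis.ofVectorSpaceIndex ℂ (FinestLC H)) := by
      rw [← Cardinal.mk_le_aleph0_iff, b.mk_eq_rank'']
      have h : Module.rank ℂ (⊤ : Submodule ℂ H) ≤ Cardinal.aleph0 := by
        rw [← top_le_iff.1 hx]
        exact (rank_span_le _).trans (Cardinal.mk_le_aleph0_iff.2 (Set.countable_range _))
      rwa [rank_top] at h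
    exact isTopologicalRing_of_exists_mul_bound fun r _ => FinestLC.exists_mul_bound b r

end FinestLC

/-! ### The Hopf `⊗̂`-algebra of an affine Hopf algebra -/

section AlgebraicTensors

theorem TensorProduct.congr_of_tmul {E F G : Type*} [AddCommGroup E] [Module ℂ E]
    [AddCommGroup F] [Module ℂ F] [AddCommGroup G] [Module ℂ G] {f g : E ⊗[ℂ] F →ₗ[ℂ] G}
    (h : ∀ x y, f (x ⊗ₜ y) = g (x ⊗ₜ y)) (u : E ⊗[ℂ] F) : f u = g u :=
  LinearMap.congr_fun (TensorProduct.ext' h) u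

namespace CompletedTensor

variable {E F G E' F' : Type*}
  [AddCommGroup E] [Module ℂ E] [TopologicalSpace E] [AddCommGroup F] [Module ℂ F]
  [TopologicalSpace F] [AddCommGroup G] [Module ℂ G] [TopologicalSpace G]
  [AddCommGroup E'] [Module ℂ E'] [TopologicalSpace E'] [AddCommGroup F'] [Module ℂ F']
  [TopologicalSpace F']

theorem map_ofTensor (f : E →L[ℂ] E') (g : F →L[ℂ] F') (u : E ⊗[ℂ] F) :
    map f g (ofTensor u) = ofTensor (TensorProduct.map f.toLinearMap g.toLinearMap u) := by
  rw [map, ofTensor_apply, ContinuousLinearMap.completion_apply_coe]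
  rfl

variable (E F G) in
/-- The canonical map from the algebraic triple tensor product to the completed one. -/
def ofTensor₃ : E ⊗[ℂ] (F ⊗[ℂ] G) →ₗ[ℂ] CompletedTensor E (CompletedTensor F G) :=
  ofTensor ∘ₗ LinearMap.lTensor E ofTensor

theorem assoc_ctmul_ofTensor (u : E ⊗[ℂ] F) (z : G) :
    assoc E F G (ctmul (ofTensor u) z) =
      ofTensor₃ E F G (TensorProduct.assoc ℂ E F G (u ⊗ₜ z)) := by
  induction u with
  | zero =>
    rw [map_zero, TensorProduct.zero_tmul, map_zero, map_zero, ← mk_apply, map_zero,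
      LinearMap.zero_apply, map_zero]
  | tmul x y => exact assoc_ctmul E F G x y z
  | add u v hu hv =>
    rw [map_add, TensorProduct.add_tmul, map_add, map_add, ← hu, ← hv, ← mk_apply, map_add,
      LinearMap.add_apply, map_add]
    rfl

theorem mulMap_ofTensor (A : Type*) [Ring A] [Algebra ℂ A] [UniformSpace A] [ProjAlgebra A]
    (u : A ⊗[ℂ] A) : mulMap A (ofTensor u) = LinearMap.mul' ℂ A u :=
  TensorProduct.congr_of_tmul (f := (mulMap A).toLinearMap ∘ₗ ofTensor) (g := LinearMap.mul' ℂ A)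
    (mulMap_ctmul A) u

/-- The canonical homomorphism from the algebraic tensor product of `⊗̂`-algebras to the completed
one. -/
def ofTensorAlgHom (A B : Type*) [Ring A] [Algebra ℂ A] [UniformSpace A] [ProjAlgebra A]
    [Ring B] [Algebra ℂ B] [UniformSpace B] [ProjAlgebra B] :
    A ⊗[ℂ] B →ₐ[ℂ] CompletedTensor A B :=
  (Completion.coeAlgHom (ProjTensor A B)).toAlgHom

end CompletedTensor

end AlgebraicTensors

section HopfStructure

open CompletedTensor

variable (H : Type u) [Ring H] [HopfAlgebra ℂ H]

instance FinestLC.instHopfAlgebra : HopfAlgebra ℂ (FinestLC H) :=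
  inferInstanceAs (HopfAlgebra ℂ H)

variable [ProjAlgebra (FinestLC H)]

/-- The comultiplication of `H` with values in the complete projective tensor square. -/
def FinestLC.comulHom : FinestLC H →A[ℂ] CompletedTensor (FinestLC H) (FinestLC H) :=
  { (ofTensorAlgHom (FinestLC H) (FinestLC H)).comp (Bialgebra.comulAlgHom ℂ (FinestLC H)) with
    cont := continuous_linearMap (((ofTensorAlgHom (FinestLC H) (FinestLC H)).comp
      (Bialgebra.comulAlgHom ℂ (FinestLC H))).toLinearMap) }

theorem FinestLC.comulHom_apply (a : FinestLC H) :
    FinestLC.comulHom H a = ofTensor (CoalgebraStruct.comul (R := ℂ) a) := rfl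

/-- The Hopf `⊗̂`-algebra structure on `H` with the strongest locally convex topology. -/
def FinestLC.hopfProjAlgebra : HopfProjAlgebra (FinestLC H) where
  comul := FinestLC.comulHom H
  counit :=
    { Bialgebra.counitAlgHom ℂ (FinestLC H) with
      cont := continuous_linearMap (Bialgebra.counitAlgHom ℂ (FinestLC H)).toLinearMap }
  antipode := ⟨HopfAlgebraStruct.antipode ℂ, continuous_linearMap _⟩
  coassoc a := by
    have hl : ∀ u : FinestLC H ⊗[ℂ] FinestLC H,
        CompletedTensor.assoc _ _ _ (CompletedTensor.map
          (FinestLC.comulHom H).toContinuousLinearMap (ContinuousLinearMap.id ℂ _) (ofTensor u)) =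
        ofTensor₃ _ _ _ (TensorProduct.assoc ℂ _ _ _
          (CoalgebraStruct.comul.rTensor (FinestLC H) u)) := fun u =>
      TensorProduct.congr_of_tmul
        (f := (CompletedTensor.assoc _ _ _).toLinearMap ∘ₗ (CompletedTensor.map
          (FinestLC.comulHom H).toContinuousLinearMap
          (ContinuousLinearMap.id ℂ _)).toLinearMap ∘ₗ ofTensor)
        (g := ofTensor₃ _ _ _ ∘ₗ (TensorProduct.assoc ℂ _ _ _).toLinearMap ∘ₗ
          CoalgebraStruct.comul.rTensor (FinestLC H))
        (fun x y => by
          have h1 := map_ctmul (FinestLC.comulHom H).toContinuousLinearMap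
            (ContinuousLinearMap.id ℂ _) x y
          exact (congrArg _ h1).trans (assoc_ctmul_ofTensor _ y)) u
    have hr : ∀ u : FinestLC H ⊗[ℂ] FinestLC H,
        CompletedTensor.map (ContinuousLinearMap.id ℂ _)
          (FinestLC.comulHom H).toContinuousLinearMap (ofTensor u) =
        ofTensor₃ _ _ _ (CoalgebraStruct.comul.lTensor (FinestLC H) u) := fun u =>
      TensorProduct.congr_of_tmul (f := (CompletedTensor.map (ContinuousLinearMap.id ℂ _)
          (FinestLC.comulHom H).toContinuousLinearMap).toLinearMap ∘ₗ ofTensor)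
        (g := ofTensor₃ _ _ _ ∘ₗ CoalgebraStruct.comul.lTensor (FinestLC H))
        (fun x y => map_ctmul (ContinuousLinearMap.id ℂ _)
          (FinestLC.comulHom H).toContinuousLinearMap x y) u
    rw [FinestLC.comulHom_apply, hl, hr, Coalgebra.coassoc_apply]
  counit_comul_left a := by
    rw [FinestLC.comulHom_apply, map_ofTensor]
    exact congrArg ofTensor (Coalgebra.rTensor_counit_comul (R := ℂ) a)
  counit_comul_right a := by
    rw [FinestLC.comulHom_apply, map_ofTensor]
    exact congrArg ofTensor (Coalgebra.lTensor_counit_comul (R := ℂ) a)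
  antipode_left a := by
    rw [FinestLC.comulHom_apply, map_ofTensor, mulMap_ofTensor]
    exact HopfAlgebra.mul_antipode_rTensor_comul_apply (R := ℂ) a
  antipode_right a := by
    rw [FinestLC.comulHom_apply, map_ofTensor, mulMap_ofTensor]
    exact HopfAlgebra.mul_antipode_lTensor_comul_apply (R := ℂ) a

theorem FinestLC.isInducedByHopf : IsInducedByHopf (FinestLC.hopfProjAlgebra H) where
  comul _ := rfl
  counit _ := rfl
  antipode _ := rfl

end HopfStructure

/-! ### The Arens–Michael envelope -/

/-- The algebra `H`, to be endowed with the topology generated by its submultiplicative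
seminorms. -/
def SubmultTop (H : Type u) : Type u := H

section Envelope

open UniformSpace

variable (H : Type u) [Ring H]

instance : Ring (SubmultTop H) := inferInstanceAs (Ring H)

variable [Algebra ℂ H]

instance : Algebra ℂ (SubmultTop H) := inferInstanceAs (Algebra ℂ H)

namespace SubmultTop

/-- The family of all submultiplicative seminorms. -/
def seminormFamily : SeminormFamily ℂ (SubmultTop H)
    {p : Seminorm ℂ (SubmultTop H) // ∀ a b, p (a * b) ≤ p a * p b} :=
  fun p => p.1

instance : UniformSpace (SubmultTop H) := seminormUniformSpace (seminormFamily H)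

instance : IsUniformAddGroup (SubmultTop H) :=
  seminormUniformSpace_isUniformAddGroup _

theorem withSeminorms : WithSeminorms (seminormFamily H) :=
  seminormUniformSpace_withSeminorms _

instance : PolynormableSpace ℂ (SubmultTop H) := (withSeminorms H).toPolynormableSpace

instance : ContinuousSMul ℂ (SubmultTop H) := (withSeminorms H).continuousSMul

instance : UniformContinuousConstSMul ℂ (SubmultTop H) :=
  uniformContinuousConstSMul_of_continuousConstSMul _ _

theorem isLocallyMConvex : IsLocallyMConvex (SubmultTop H) :=
  .of_withSeminorms (withSeminorms H) fun p => p.2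

instance : IsTopologicalRing (SubmultTop H) :=
  isTopologicalRing_of_exists_mul_bound fun r hr => by
    obtain ⟨p, hp, hmul, C, hC, h⟩ := isLocallyMConvex H r hr
    refine ⟨Real.toNNReal C • p, hp.const_smul (Real.toNNReal C), p, hp, fun u v => ?_⟩
    change r (u * v) ≤ (Real.toNNReal C : ℝ) * p u * p v
    rw [Real.coe_toNNReal _ hC, mul_assoc]
    exact (h _).trans (mul_le_mul_of_nonneg_left (hmul u v) hC)

instance : ProjAlgebra (Completion (SubmultTop H)) := Completion.projAlgebra _

instance : ArensMichaelAlgebra (Completion (SubmultTop H)) :=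
  (isLocallyMConvex H).completion.arensMichaelAlgebra

variable {H} in
/-- A homomorphism to an Arens–Michael algebra is continuous for the topology generated by the
submultiplicative seminorms. -/
theorem continuous_algHom {B : Type*} [Ring B] [Algebra ℂ B] [UniformSpace B]
    [ArensMichaelAlgebra B] (φ : SubmultTop H →ₐ[ℂ] B) : Continuous φ := by
  obtain ⟨P, hP, hW⟩ := ArensMichaelAlgebra.exists_submultiplicative (A := B)
  exact hW.continuous_of_continuous_comp φ.toLinearMap fun p =>
    (withSeminorms H).continuous_seminorm ⟨p.1.comp φ.toLinearMap, fun a b => by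
      simpa using hP p p.2 (φ a) (φ b)⟩

/-- The identity of `H`, from the strongest locally convex topology to the topology generated by
the submultiplicative seminorms. -/
def ofFinestLC : FinestLC H →ₐ[ℂ] SubmultTop H := AlgHom.id ℂ H

/-- The canonical homomorphism from `H` to the completion of `H` for the topology generated by the
submultiplicative seminorms. -/
def toCompletion : FinestLC H →A[ℂ] Completion (SubmultTop H) :=
  (Completion.coeAlgHom (SubmultTop H)).comp
    { ofFinestLC H with
      cont := FinestLC.continuous_linearMap (ofFinestLC H).toLinearMap }

theorem denseRange_toCompletion : DenseRange (toCompletion H) :=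
  Completion.denseRange_coe (α := SubmultTop H)

variable {H} in
theorem exists_comp_toCompletion_eq {B : Type*} [Ring B] [Algebra ℂ B] [UniformSpace B]
    [ArensMichaelAlgebra B] (φ : FinestLC H →A[ℂ] B) :
    ∃ ψ : Completion (SubmultTop H) →A[ℂ] B, ψ.comp (toCompletion H) = φ := by
  let φ' : SubmultTop H →ₐ[ℂ] B := φ.toAlgHom
  have hφ' : Continuous φ' := continuous_algHom φ'
  refine ⟨{ Completion.extensionHom (φ' : SubmultTop H →+* B) hφ' with
    commutes' := fun c => (Completion.extensionHom_coe (φ' : SubmultTop H →+* B) hφ' _).trans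
      (φ'.commutes c)
    cont := Completion.continuous_extension }, ?_⟩
  ext a
  exact Completion.extensionHom_coe (φ' : SubmultTop H →+* B) hφ' a

end SubmultTop

theorem ContinuousAlgHom.eq_of_comp_eq_of_denseRange {A B C : Type*} [Ring A] [Algebra ℂ A]
    [TopologicalSpace A] [Ring B] [Algebra ℂ B] [TopologicalSpace B] [Ring C] [Algebra ℂ C]
    [TopologicalSpace C] [T2Space C] {ι : A →A[ℂ] B} (hι : DenseRange ι) {f g : B →A[ℂ] C}
    (h : f.comp ι = g.comp ι) : f = g :=
  DFunLike.coe_injective <| hι.equalizer f.continuous g.continuous <|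
    congrArg (DFunLike.coe : (A →A[ℂ] C) → A → C) h

theorem SubmultTop.isArensMichaelEnvelope : IsArensMichaelEnvelope (SubmultTop.toCompletion H) := by
  intro B _ _ _ _ φ
  obtain ⟨ψ, hψ⟩ := SubmultTop.exists_comp_toCompletion_eq φ
  exact ⟨ψ, hψ, fun ψ' h => ContinuousAlgHom.eq_of_comp_eq_of_denseRange
    (SubmultTop.denseRange_toCompletion H) (h.trans hψ.symm)⟩

namespace IsArensMichaelEnvelope

variable {H} {A : Type u} [Ring A] [Algebra ℂ A] [UniformSpace A] [ArensMichaelAlgebra A]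
  {ι : FinestLC H →A[ℂ] A}

/-- Any two envelopes of `H` are isomorphic; here the second one is the completion of `H` for the
topology generated by the submultiplicative seminorms. -/
theorem exists_inverse (h : IsArensMichaelEnvelope ι) :
    ∃ (f : Completion (SubmultTop H) →A[ℂ] A) (g : A →A[ℂ] Completion (SubmultTop H)),
      f.comp (SubmultTop.toCompletion H) = ι ∧ g.comp ι = SubmultTop.toCompletion H ∧
        (∀ a, f (g a) = a) ∧ ∀ b, g (f b) = b := by
  obtain ⟨f, hf, -⟩ := SubmultTop.isArensMichaelEnvelope H A ι
  obtain ⟨g, hg, -⟩ := h _ (SubmultTop.toCompletion H)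
  have hfg : f.comp g = .id ℂ A := (h A ι).unique (by
    change f.comp (g.comp ι) = ι
    rw [hg, hf]) rfl
  have hgf : g.comp f = .id ℂ _ := (SubmultTop.isArensMichaelEnvelope H _ _).unique (by
    change g.comp (f.comp (SubmultTop.toCompletion H)) = SubmultTop.toCompletion H
    rw [hf, hg]) rfl
  exact ⟨f, g, hf, hg, DFunLike.congr_fun hfg, DFunLike.congr_fun hgf⟩

theorem denseRange (h : IsArensMichaelEnvelope ι) : DenseRange ι := by
  obtain ⟨f, g, hf, -, hfg, -⟩ := h.exists_inverse
  rw [← hf]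
  exact (Function.RightInverse.surjective hfg).denseRange.comp
    (SubmultTop.denseRange_toCompletion H) f.continuous

/-- The universal property of an envelope of `H` extends to Arens–Michael algebras in any
universe. -/
theorem exists_comp_eq (h : IsArensMichaelEnvelope ι) {B : Type*} [Ring B] [Algebra ℂ B]
    [UniformSpace B] [ArensMichaelAlgebra B] (φ : FinestLC H →A[ℂ] B) :
    ∃ ψ : A →A[ℂ] B, ∀ a, ψ (ι a) = φ a := by
  obtain ⟨f, g, -, hg, -, -⟩ := h.exists_inverse
  obtain ⟨ψ, hψ⟩ := SubmultTop.exists_comp_toCompletion_eq φ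
  refine ⟨ψ.comp g, fun a => ?_⟩
  rw [← hψ, ← hg]
  rfl

end IsArensMichaelEnvelope

end Envelope

/-! ### Expansions in entire functions of the generators -/

section Expansion

open Finsupp

variable {W V : Type*} [AddCommGroup V] [Module ℂ V]

theorem weightedSeminorm_mono {a b : W → NNReal} (h : a ≤ b) (c : W →₀ ℂ) :
    weightedSeminorm a c ≤ weightedSeminorm b c :=
  (summable_weight_mul_norm a c).tsum_le_tsum
    (fun w => mul_le_mul_of_nonneg_right (h w) (norm_nonneg _)) (summable_weight_mul_norm b c)

/-- A sequence of finitely supported families whose consecutive differences are geometrically small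
for increasing weights converges, in each weighted `ℓ¹` norm, to a family. -/
theorem exists_forall_sum_sub_le (a : ℕ → W → NNReal) (ha : Monotone a) (ha1 : ∀ m w, 1 ≤ a m w)
    (s : ℕ → W →₀ ℂ) (hs : ∀ k, weightedSeminorm (a k) (s (k + 1) - s k) ≤ 2 / 2 ^ k) :
    ∃ c : W → ℂ, ∀ m K, m ≤ K → ∀ J : Finset W,
      ∑ w ∈ J, (a m w : ℝ) * ‖c w - s K w‖ ≤ 4 / 2 ^ K := by
  have hle : ∀ m K j, m ≤ K →
      weightedSeminorm (a m) (s (K + j) - s K) ≤ 4 / 2 ^ K - 4 / 2 ^ (K + j) := by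
    intro m K j hm
    induction j with
    | zero => simp
    | succ j ih =>
      have h1 : s (K + (j + 1)) - s K = (s (K + j + 1) - s (K + j)) + (s (K + j) - s K) := by
        rw [← add_assoc]; abel
      have h2 := (weightedSeminorm_mono (ha (hm.trans (Nat.le_add_right K j)))
        (s (K + j + 1) - s (K + j))).trans (hs (K + j))
      have h3 : (4 : ℝ) / 2 ^ (K + (j + 1)) = 2 / 2 ^ (K + j) := by
        rw [← add_assoc, pow_succ]
        field_simp
        norm_num
      have h4 : (4 : ℝ) / 2 ^ (K + j) = 2 * (2 / 2 ^ (K + j)) := by ring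
      rw [h1, h3]
      refine (map_add_le_add _ _ _).trans ?_
      linarith
  have hcoord : ∀ w, ∃ z, Filter.Tendsto (fun L => s L w) Filter.atTop (𝓝 z) := by
    intro w
    refine cauchySeq_tendsto_of_complete (cauchySeq_of_le_geometric_two (C := 4) fun k => ?_)
    have h1 := (sum_le_weightedSeminorm (a k) (s (k + 1) - s k) {w}).trans (hs k)
    rw [Finset.sum_singleton, Finsupp.sub_apply] at h1
    rw [dist_comm, dist_eq_norm]
    have h2 : ‖s (k + 1) w - s k w‖ ≤ (a k w : ℝ) * ‖s (k + 1) w - s k w‖ :=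
      le_mul_of_one_le_left (norm_nonneg _) (ha1 k w)
    refine h2.trans (h1.trans (le_of_eq ?_))
    norm_num
  choose c hc using hcoord
  refine ⟨c, fun m K hm J => ?_⟩
  have ht := tendsto_finsetSum J
    fun w _ => (((hc w).sub_const (s K w)).norm.const_mul (a m w : ℝ))
  refine le_of_tendsto ht (Filter.eventually_atTop.2 ⟨K, fun L hL => ?_⟩)
  obtain ⟨j, rfl⟩ := Nat.exists_eq_add_of_le hL
  refine (sum_le_weightedSeminorm (a m) (s (K + j) - s K) J).trans ((hle m K j hm).trans ?_)
  have : (0 : ℝ) ≤ 4 / 2 ^ (K + j) := by positivity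
  linarith

/-- If the topology of `E` is given by extensions of the quotients of an increasing sequence of
weighted `ℓ¹` seminorms along a spanning family of a dense subspace, then every element of `E` is
the sum of a series in that family, which converges absolutely for all the weights. -/
theorem exists_hasSum_of_spanSeminorm {v : W → V}
    (hv : ⊤ ≤ Submodule.span ℂ (Set.range v)) (a : ℕ → W → NNReal) (ha : Monotone a)
    (ha1 : ∀ m w, 1 ≤ a m w) {E : Type*} [AddCommGroup E] [Module ℂ E] [TopologicalSpace E]
    (j : V →ₗ[ℂ] E) (hj : DenseRange j) (Q : SeminormFamily ℂ E ℕ) (hQ : WithSeminorms Q)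
    (hQj : ∀ m x, Q m (j x) = spanSeminorm v hv (a m) x) (y : E) :
    ∃ c : W → ℂ, (∀ m, Summable fun w => (a m w : ℝ) * ‖c w‖) ∧
      HasSum (fun w => c w • j (v w)) y := by
  have := hQ.topologicalAddGroup
  have hQc : ∀ m, Continuous (Q m) := hQ.continuous_seminorm
  have hmono : ∀ {m K}, m ≤ K → ∀ z, Q m z ≤ Q K z := fun {m K} hm z => by
    refine hj.induction_on z (isClosed_le (hQc m) (hQc K)) fun x => ?_
    rw [hQj, hQj, ← one_mul (spanSeminorm v hv (a K) x)]
    refine le_spanSeminorm hv _ _ zero_le_one (fun w => ?_) x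
    rw [one_mul]
    exact (spanSeminorm_le hv (a m) w).trans (ha hm w)
  have happrox : ∀ k, ∃ h : V, Q k (y - j h) < 1 / 2 ^ k := fun k =>
    hj.exists_mem_open (isOpen_lt ((hQc k).comp (continuous_const.sub continuous_id))
      continuous_const) ⟨y, by simp⟩
  choose h hh using happrox
  have hstep : ∀ k, spanSeminorm v hv (a k) (h (k + 1) - h k) < 2 / 2 ^ k := fun k => by
    have e : j (h (k + 1) - h k) = (y - j (h k)) - (y - j (h (k + 1))) := by
      rw [map_sub]; abel
    rw [← hQj, e]
    have h1 := map_sub_le_add (Q k) (y - j (h k)) (y - j (h (k + 1)))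
    have h2 := (hmono (Nat.le_succ k) (y - j (h (k + 1)))).trans_lt (hh (k + 1))
    have h3 : (1 : ℝ) / 2 ^ (k + 1) ≤ 1 / 2 ^ k :=
      one_div_le_one_div_of_le (by positivity) (pow_le_pow_right₀ one_le_two (Nat.le_succ k))
    have h4 : (2 : ℝ) / 2 ^ k = 1 / 2 ^ k + 1 / 2 ^ k := by ring
    have := hh k
    linarith
  have hd : ∀ k, ∃ d, linearCombination ℂ v d = h (k + 1) - h k ∧
      weightedSeminorm (a k) d < 2 / 2 ^ k := fun k => exists_weightedSeminorm_lt hv (hstep k)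
  choose d hdh hdn using hd
  obtain ⟨c₀, hc₀⟩ :=
    (Finsupp.mem_span_range_iff_exists_finsupp).1 (hv (Submodule.mem_top (x := h 0)))
  -- `s K` represents the `K`-th approximation `h K`, and consecutive differences `d k` are small.
  let s : ℕ → W →₀ ℂ := fun K => c₀ + ∑ k ∈ Finset.range K, d k
  have hs : ∀ K, linearCombination ℂ v (s K) = h K := fun K => by
    rw [map_add, map_sum, Finset.sum_congr rfl fun k _ => hdh k, Finset.sum_range_sub h K]
    exact (congrArg (· + _) hc₀).trans (add_sub_cancel _ _)
  obtain ⟨c, hc⟩ := exists_forall_sum_sub_le a ha ha1 s fun k => by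
    have : s (k + 1) - s k = d k := by
      simp only [s, Finset.sum_range_succ]
      abel
    rw [this]
    exact (hdn k).le
  refine ⟨c, fun m => ?_, (hQ.tendsto_nhds _ _).2 fun m ε hε => ?_⟩
  · refine summable_of_sum_le (c := 4 / 2 ^ m + weightedSeminorm (a m) (s m))
      (fun w => mul_nonneg (a m w).2 (norm_nonneg _)) fun J => ?_
    refine le_trans ?_ (add_le_add (hc m m le_rfl J) (sum_le_weightedSeminorm (a m) (s m) J))
    rw [← Finset.sum_add_distrib]
    refine Finset.sum_le_sum fun w _ => ?_
    rw [← mul_add]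
    refine mul_le_mul_of_nonneg_left ?_ (a m w).2
    simpa using norm_add_le (c w - s m w) (s m w)
  · have hlim : Filter.Tendsto (fun K : ℕ => (5 : ℝ) / 2 ^ K) Filter.atTop (𝓝 0) :=
      (tendsto_pow_atTop_atTop_of_one_lt one_lt_two).const_div_atTop 5
    obtain ⟨K, hKm, hKε⟩ := ((Filter.eventually_ge_atTop m).and
      (hlim.eventually_lt_const hε)).exists
    filter_upwards [Filter.eventually_ge_atTop (s K).support] with J hJ
    -- The finite set `J` contains the support of `s K`, so the partial sum over `J` differs from
    -- `h K` by at most `4 / 2 ^ K`, and `h K` differs from `y` by at most `1 / 2 ^ K`.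
    have e1 : h K = ∑ w ∈ J, s K w • v w := by
      rw [← hs K, linearCombination_apply]
      exact Finsupp.sum_of_support_subset _ hJ _ (by simp)
    have e2 : ∑ w ∈ J, c w • j (v w) - y =
        ∑ w ∈ J, (c w - s K w) • j (v w) - (y - j (h K)) := by
      simp only [sub_smul, Finset.sum_sub_distrib]
      rw [e1, map_sum]
      simp only [map_smul]
      abel
    have h1 : Q m (∑ w ∈ J, (c w - s K w) • j (v w)) ≤ 4 / 2 ^ K := by
      refine (Finset.le_sum_of_subadditive (Q m) (map_zero _).le (map_add_le_add _) _ _).trans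
        ((Finset.sum_le_sum fun w _ => ?_).trans (hc m K hKm J))
      rw [map_smul_eq_mul, mul_comm, hQj]
      exact mul_le_mul_of_nonneg_right (spanSeminorm_le hv (a m) w) (norm_nonneg _)
    have h2 := (hmono hKm (y - j (h K))).trans_lt (hh K)
    have h3 : (5 : ℝ) / 2 ^ K = 4 / 2 ^ K + 1 / 2 ^ K := by ring
    rw [e2]
    have := map_sub_le_add (Q m) (∑ w ∈ J, (c w - s K w) • j (v w)) (y - j (h K))
    linarith

/-- The quotient of a weighted `ℓ¹` seminorm with submultiplicative weights is submultiplicative. -/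
theorem spanSeminorm_mul_le {M A : Type*} [Monoid M] [Ring A] [Algebra ℂ A] (v : M →* A)
    (hv : ⊤ ≤ Submodule.span ℂ (Set.range v)) (a : M → NNReal)
    (ha : ∀ w u, a (w * u) ≤ a w * a u) (x y : A) :
    spanSeminorm v hv a (x * y) ≤ spanSeminorm v hv a x * spanSeminorm v hv a y := by
  have h1 : ∀ w, spanSeminorm v hv a (v w * y) ≤ a w * spanSeminorm v hv a y := fun w =>
    le_spanSeminorm hv ((spanSeminorm v hv a).comp (LinearMap.mulLeft ℂ (v w))) a (a w).2
      (fun u => by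
        rw [Seminorm.comp_apply, LinearMap.mulLeft_apply, ← map_mul]
        exact (spanSeminorm_le hv a (w * u)).trans (ha w u)) y
  rw [mul_comm]
  exact le_spanSeminorm hv ((spanSeminorm v hv a).comp (LinearMap.mulRight ℂ y)) a
    (apply_nonneg _ _) (fun w => (h1 w).trans_eq (mul_comm _ _)) x

/-- A submultiplicative seminorm grows at most geometrically with the length of words. -/
theorem exists_seminorm_word_le {A : Type*} [Ring A] [Algebra ℂ A] (p : Seminorm ℂ A)
    (hp : ∀ a b, p (a * b) ≤ p a * p b) {n : ℕ} (x : Fin n → A) :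
    ∃ k : ℕ, ∀ w, p (FreeMonoid.lift x w) ≤ p 1 * ((k : ℝ) + 1) ^ w.length := by
  obtain ⟨k, hk⟩ := exists_nat_ge (∑ i, p (x i))
  refine ⟨k, fun w => ?_⟩
  induction w using FreeMonoid.inductionOn' with
  | one => simp
  | of_mul i w ih =>
    have h1 : p (x i) ≤ k + 1 :=
      ((Finset.single_le_sum (f := fun i => p (x i)) (fun _ _ => apply_nonneg p _)
        (Finset.mem_univ i)).trans hk).trans (by linarith)
    rw [map_mul, FreeMonoid.lift_eval_of, FreeMonoid.length_mul, FreeMonoid.length_of, pow_add,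
      pow_one]
    calc p (x i * FreeMonoid.lift x w) ≤ p (x i) * p (FreeMonoid.lift x w) := hp _ _
      _ ≤ (k + 1) * (p 1 * ((k : ℝ) + 1) ^ w.length) :=
          mul_le_mul h1 ih (apply_nonneg _ _) (by positivity)
      _ = p 1 * (((k : ℝ) + 1) * ((k : ℝ) + 1) ^ w.length) := by ring

end Expansion

section HFG

open UniformSpace

theorem SubmultTop.isHFG (H : Type u) [Ring H] [Algebra ℂ H] [Algebra.FiniteType ℂ H] :
    IsHFG (Completion (SubmultTop H)) := by
  obtain ⟨n, x, hv⟩ : ∃ (n : ℕ) (x : Fin n → SubmultTop H),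
    ⊤ ≤ Submodule.span ℂ (Set.range (FreeMonoid.lift x)) := exists_span_words_eq_top H
  -- The base is `m + 1` rather than `m` so that all weights are at least `1`.
  let a : ℕ → FreeMonoid (Fin n) → NNReal := fun m w => ((m : NNReal) + 1) ^ w.length
  have ha : Monotone a := fun m k hmk w => by
    have : (m : NNReal) ≤ k := by exact_mod_cast hmk
    exact pow_le_pow_left₀ zero_le (by gcongr) _
  have ha1 : ∀ m w, 1 ≤ a m w := fun m w => one_le_pow₀ le_add_self
  have hmul : ∀ m (b c : SubmultTop H), spanSeminorm _ hv (a m) (b * c) ≤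
      spanSeminorm _ hv (a m) b * spanSeminorm _ hv (a m) c := fun m =>
    spanSeminorm_mul_le (FreeMonoid.lift x) hv (a m) fun w u => by
      simp only [a, FreeMonoid.length_mul, pow_add, le_refl]
  have hqc : ∀ m, Continuous (spanSeminorm _ hv (a m)) := fun m =>
    (SubmultTop.withSeminorms H).continuous_seminorm ⟨spanSeminorm _ hv (a m), hmul m⟩
  let Q : SeminormFamily ℂ (Completion (SubmultTop H)) ℕ :=
    fun m => (spanSeminorm _ hv (a m)).completionExtension (hqc m)
  have hQ : WithSeminorms Q := by
    refine (PolynormableSpace.withSeminorms ℂ _).congr (fun m => ?_) fun r => ?_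
    · exact ⟨{⟨Q m, Seminorm.continuous_completionExtension _ _⟩}, 1, fun b => by simp⟩
    · obtain ⟨p, hp, hpm, C, hC, hle⟩ := SubmultTop.isLocallyMConvex H
        (r.1.comp (Completion.coeAlgHom (SubmultTop H)).toContinuousLinearMap.toLinearMap)
        (r.2.comp (Completion.continuous_coe (SubmultTop H)))
      obtain ⟨k, hk⟩ := exists_seminorm_word_le p hpm x
      have hC' : 0 ≤ C * p 1 := mul_nonneg hC (apply_nonneg _ _)
      refine ⟨{k}, ⟨C * p 1, hC'⟩, fun b => ?_⟩
      have : r.1 b ≤ C * p 1 * Q k b := by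
        refine Completion.induction_on b (isClosed_le r.2 (continuous_const.mul
          (Seminorm.continuous_completionExtension _ (hqc k)))) fun b => ?_
        rw [Seminorm.completionExtension_coe, mul_assoc]
        refine (hle b).trans (mul_le_mul_of_nonneg_left ?_ hC)
        refine le_spanSeminorm hv p (a k) (apply_nonneg _ _) (fun w => (hk w).trans_eq ?_) b
        simp [a]
      simpa using! this
  constructor
  · have := hQ.firstCountableTopology
    have : (uniformity (Completion (SubmultTop H))).IsCountablyGenerated :=
      IsUniformAddGroup.uniformity_countably_generated
    exact UniformSpace.metrizableSpace
  · refine ⟨n, fun i => (x i : Completion (SubmultTop H)), fun y => ?_⟩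
    obtain ⟨c, hc, hsum⟩ := exists_hasSum_of_spanSeminorm hv a ha ha1
      (Completion.coeAlgHom (SubmultTop H)).toContinuousLinearMap.toLinearMap
      Completion.denseRange_coe Q hQ
      (fun m b => Seminorm.completionExtension_coe _ (hqc m) b) y
    refine ⟨c, fun ρ hρ => ?_, ?_⟩
    · obtain ⟨m, hm⟩ := exists_nat_ge ρ
      refine (hc m).of_nonneg_of_le (fun w => by positivity) fun w => ?_
      rw [mul_comm]
      refine mul_le_mul_of_nonneg_right ?_ (norm_nonneg _)
      simp only [a, NNReal.coe_pow, NNReal.coe_add, NNReal.coe_natCast, NNReal.coe_one]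
      exact pow_le_pow_left₀ hρ.le (by linarith) _
    · convert! hsum using 3 with w
      exact (FreeMonoid.hom_map_lift
        ((Completion.coeAlgHom (SubmultTop H) : SubmultTop H →A[ℂ] _) :
          SubmultTop H →* Completion (SubmultTop H)) x w).symm

theorem IsArensMichaelEnvelope.isHFG {H : Type u} [Ring H] [Algebra ℂ H] [Algebra.FiniteType ℂ H]
    {A : Type u} [Ring A] [Algebra ℂ A] [UniformSpace A] [ArensMichaelAlgebra A]
    {ι : FinestLC H →A[ℂ] A} (h : IsArensMichaelEnvelope ι) : IsHFG A := by
  obtain ⟨f, g, -, -, hfg, hgf⟩ := h.exists_inverse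
  obtain ⟨hmet, n, x, hx⟩ := SubmultTop.isHFG H
  let e : A ≃ₜ Completion (SubmultTop H) := ⟨⟨g, f, hfg, hgf⟩, g.continuous, f.continuous⟩
  refine ⟨e.isEmbedding.metrizableSpace, n, fun i => f (x i), fun y => ?_⟩
  obtain ⟨c, hc, hsum⟩ := hx (g y)
  refine ⟨c, hc, ?_⟩
  have := hsum.map f f.continuous
  rw [hfg] at this
  convert! this using 2 with w
  rw [Function.comp_apply, map_smul]
  congr 1
  exact (FreeMonoid.hom_map_lift
    (f : Completion (SubmultTop H) →* A) x w).symm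

end HFG

/-! ### The Hopf `⊗̂`-algebra structure of the envelope -/

section EnvelopeHopf

namespace CompletedTensor

section Functoriality

variable {E F G E' F' G' E'' F'' : Type*}
  [AddCommGroup E] [Module ℂ E] [TopologicalSpace E] [AddCommGroup F] [Module ℂ F]
  [TopologicalSpace F] [AddCommGroup G] [Module ℂ G] [TopologicalSpace G]
  [AddCommGroup E'] [Module ℂ E'] [TopologicalSpace E'] [AddCommGroup F'] [Module ℂ F']
  [TopologicalSpace F'] [AddCommGroup G'] [Module ℂ G'] [TopologicalSpace G']
  [AddCommGroup E''] [Module ℂ E''] [TopologicalSpace E''] [AddCommGroup F''] [Module ℂ F'']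
  [TopologicalSpace F'']

theorem map_map (f' : E' →L[ℂ] E'') (g' : F' →L[ℂ] F'') (f : E →L[ℂ] E') (g : F →L[ℂ] F')
    (u : CompletedTensor E F) : map f' g' (map f g u) = map (f'.comp f) (g'.comp g) u := by
  have : (map f' g').comp (map f g) = map (f'.comp f) (g'.comp g) := ext_ctmul fun x y => by
    rw [ContinuousLinearMap.comp_apply, map_ctmul, map_ctmul, map_ctmul]
    rfl
  exact DFunLike.congr_fun this u

variable (E) in
/-- The continuous linear map `x ↦ x ⊗ y`. -/
def ctmulRight [IsTopologicalAddGroup E] (y : F) : E →L[ℂ] CompletedTensor E F :=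
  ⟨(mk E F).flip y, by
    refine (PolynormableSpace.withSeminorms ℂ _).continuous_of_continuous_comp
      ((mk E F).flip y) fun r => ?_
    obtain ⟨p, hp, q, -, hpq⟩ := exists_bound r.1 r.2
    have hc : Continuous (Real.toNNReal (q y) • p) := hp.const_smul (Real.toNNReal (q y))
    refine Seminorm.continuous_of_le hc fun x => ?_
    refine (hpq x y).trans_eq ?_
    change p x * q y = (Real.toNNReal (q y) : ℝ) * p x
    rw [Real.coe_toNNReal _ (apply_nonneg q y), mul_comm]⟩

variable (F) in
/-- The continuous linear map `y ↦ x ⊗ y`. -/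
def ctmulLeft [IsTopologicalAddGroup F] (x : E) : F →L[ℂ] CompletedTensor E F :=
  ⟨mk E F x, by
    refine (PolynormableSpace.withSeminorms ℂ _).continuous_of_continuous_comp
      (mk E F x) fun r => ?_
    obtain ⟨p, -, q, hq, hpq⟩ := exists_bound r.1 r.2
    have hc : Continuous (Real.toNNReal (p x) • q) := hq.const_smul (Real.toNNReal (p x))
    refine Seminorm.continuous_of_le hc fun y => ?_
    refine (hpq x y).trans_eq ?_
    change p x * q y = (Real.toNNReal (p x) : ℝ) * q y
    rw [Real.coe_toNNReal _ (apply_nonneg p x)]⟩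

/-- Two continuous linear maps on a double completed tensor product agree if they agree on the
elementary tensors. -/
theorem ext_ctmul_ctmul {K : Type*} [AddCommGroup K] [Module ℂ K] [TopologicalSpace K]
    [T2Space K]
    {f g : CompletedTensor (CompletedTensor E F) G →L[ℂ] K}
    (h : ∀ x y z, f (ctmul (ctmul x y) z) = g (ctmul (ctmul x y) z)) : f = g := by
  refine ext_ctmul fun u z => ?_
  have : f.comp (ctmulRight _ z) = g.comp (ctmulRight _ z) := ext_ctmul fun x y => h x y z
  exact DFunLike.congr_fun this u

theorem assoc_map (f : E →L[ℂ] E') (g : F →L[ℂ] F') (k : G →L[ℂ] G')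
    (u : CompletedTensor (CompletedTensor E F) G) :
    assoc E' F' G' (map (map f g) k u) = map f (map g k) (assoc E F G u) := by
  have : (assoc E' F' G').comp (map (map f g) k) = (map f (map g k)).comp (assoc E F G) := by
    refine ext_ctmul_ctmul fun x y z => ?_
    rw [ContinuousLinearMap.comp_apply, ContinuousLinearMap.comp_apply, map_ctmul, map_ctmul,
      assoc_ctmul, assoc_ctmul, map_ctmul, map_ctmul]
  exact DFunLike.congr_fun this u

end Functoriality

variable {A B A' B' : Type*} [Ring A] [Algebra ℂ A] [UniformSpace A] [ProjAlgebra A]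
  [Ring B] [Algebra ℂ B] [UniformSpace B] [ProjAlgebra B]
  [Ring A'] [Algebra ℂ A'] [UniformSpace A'] [ProjAlgebra A']
  [Ring B'] [Algebra ℂ B'] [UniformSpace B'] [ProjAlgebra B']

theorem map_mulMap (f : A →A[ℂ] B) (u : CompletedTensor A A) :
    mulMap B (map f.toContinuousLinearMap f.toContinuousLinearMap u) = f (mulMap A u) := by
  have : (mulMap B).comp (map f.toContinuousLinearMap f.toContinuousLinearMap) =
      f.toContinuousLinearMap.comp (mulMap A) := ext_ctmul fun x y => by
    rw [ContinuousLinearMap.comp_apply, ContinuousLinearMap.comp_apply, map_ctmul, mulMap_ctmul,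
      mulMap_ctmul]
    exact (map_mul f x y).symm
  exact DFunLike.congr_fun this u

/-- The complete projective tensor product of continuous homomorphisms of `⊗̂`-algebras. -/
def mapAlgHom (f : A →A[ℂ] A') (g : B →A[ℂ] B') :
    CompletedTensor A B →A[ℂ] CompletedTensor A' B' :=
  { AlgHom.ofLinearMap (map f.toContinuousLinearMap g.toContinuousLinearMap).toLinearMap
      ((map_ctmul _ _ 1 1).trans (by
        change ctmul (f 1) (g 1) = _
        rw [map_one, map_one]
        rfl))
      (fun u v => by
        have hc := (map f.toContinuousLinearMap g.toContinuousLinearMap).continuous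
        refine UniformSpace.Completion.induction_on₂ u v (isClosed_eq ?_ ?_) fun u v => ?_
        · exact hc.comp continuous_mul
        · exact (hc.comp continuous_fst).mul (hc.comp continuous_snd)
        · have h : ∀ w : A ⊗[ℂ] B, map f.toContinuousLinearMap g.toContinuousLinearMap
              (ofTensor w) = ofTensorAlgHom A' B'
                (Algebra.TensorProduct.map f.toAlgHom g.toAlgHom w) := fun w => map_ofTensor _ _ w
          have hm := map_mul ((ofTensorAlgHom A' B').comp
            (Algebra.TensorProduct.map f.toAlgHom g.toAlgHom)) (toProj.symm u) (toProj.symm v)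
          rw [← UniformSpace.Completion.coe_mul]
          exact (h (toProj.symm (u * v))).trans (hm.trans
            (congrArg₂ (· * ·) (h (toProj.symm u)).symm (h (toProj.symm v)).symm))) with
    cont := (map f.toContinuousLinearMap g.toContinuousLinearMap).continuous }

end CompletedTensor

open CompletedTensor

theorem ContinuousLinearMap.eq_of_denseRange {X A G : Type*} [AddCommGroup A] [Module ℂ A]
    [TopologicalSpace A] [AddCommGroup G] [Module ℂ G] [TopologicalSpace G] [T2Space G] {ι : X → A}
    (hι : DenseRange ι) {f g : A →L[ℂ] G} (h : ∀ x, f (ι x) = g (ι x)) (a : A) : f a = g a :=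
  congrFun (hι.equalizer f.continuous g.continuous (funext h)) a

/-- The Hopf structure passes to an envelope by its universal property: the comultiplication and
the counit extend, being homomorphisms to Arens–Michael algebras, and so does the antipode, as a
homomorphism to the opposite algebra. The identities hold on the dense image of `H`. -/
theorem HopfProjAlgebra.exists_of_envelope {H : Type u} [Ring H] [HopfAlgebra ℂ H]
    [ProjAlgebra (FinestLC H)] {A : Type u} [Ring A] [Algebra ℂ A] [UniformSpace A]
    [ArensMichaelAlgebra A] {ι : FinestLC H →A[ℂ] A} (h : IsArensMichaelEnvelope ι) :
    ∃ S : HopfProjAlgebra A, IsHopfHom (FinestLC.hopfProjAlgebra H) S ι := by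
  let S := FinestLC.hopfProjAlgebra H
  obtain ⟨Δ, hΔ⟩ := h.exists_comp_eq ((mapAlgHom ι ι).comp S.comul)
  obtain ⟨ε, hε⟩ := h.exists_comp_eq S.counit
  -- The antipode of `H` is antimultiplicative, that is, a homomorphism to the opposite algebra.
  let σ : FinestLC H →A[ℂ] Aᵐᵒᵖ :=
    { (AlgHom.op ι.toAlgHom).comp (HopfAlgebra.antipodeAlgHomOp ℂ (FinestLC H)) with
      cont := FinestLC.continuous_linearMap
        ((AlgHom.op ι.toAlgHom).comp (HopfAlgebra.antipodeAlgHomOp ℂ (FinestLC H))).toLinearMap }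
  obtain ⟨T', hT'⟩ := h.exists_comp_eq σ
  let T : A →L[ℂ] A :=
    ⟨(MulOpposite.opLinearEquiv ℂ : A ≃ₗ[ℂ] Aᵐᵒᵖ).symm.toLinearMap ∘ₗ T'.toAlgHom.toLinearMap,
      MulOpposite.continuous_unop.comp T'.continuous⟩
  have hT : ∀ a, T (ι a) = ι (S.antipode a) := fun a => congrArg MulOpposite.unop (hT' a)
  have hΔ' : ∀ a, Δ (ι a) = CompletedTensor.map ι.toContinuousLinearMap ι.toContinuousLinearMap
      (S.comul a) := hΔ
  have hΔc : Δ.toContinuousLinearMap.comp ι.toContinuousLinearMap =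
      (CompletedTensor.map ι.toContinuousLinearMap ι.toContinuousLinearMap).comp
        S.comul.toContinuousLinearMap := ContinuousLinearMap.ext hΔ'
  have hεc : ε.toContinuousLinearMap.comp ι.toContinuousLinearMap =
      S.counit.toContinuousLinearMap := ContinuousLinearMap.ext hε
  have hTc : T.comp ι.toContinuousLinearMap = ι.toContinuousLinearMap.comp S.antipode :=
    ContinuousLinearMap.ext hT
  have hιc : ∀ c : ℂ, ι (algebraMap ℂ _ c) = algebraMap ℂ A c := ι.toAlgHom.commutes
  refine ⟨⟨Δ, ε, T, ?_, ?_, ?_, ?_, ?_⟩, ⟨hΔ, hε, hT⟩⟩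
  · refine ContinuousLinearMap.eq_of_denseRange h.denseRange
      (f := (CompletedTensor.assoc A A A).comp ((CompletedTensor.map Δ.toContinuousLinearMap
        (ContinuousLinearMap.id ℂ A)).comp Δ.toContinuousLinearMap))
      (g := (CompletedTensor.map (ContinuousLinearMap.id ℂ A) Δ.toContinuousLinearMap).comp
        Δ.toContinuousLinearMap) fun a => ?_
    change CompletedTensor.assoc A A A (CompletedTensor.map Δ.toContinuousLinearMap
      (ContinuousLinearMap.id ℂ A) (Δ (ι a))) =
      CompletedTensor.map (ContinuousLinearMap.id ℂ A) Δ.toContinuousLinearMap (Δ (ι a))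
    have h1 := map_map (CompletedTensor.map ι.toContinuousLinearMap ι.toContinuousLinearMap)
      ι.toContinuousLinearMap S.comul.toContinuousLinearMap (ContinuousLinearMap.id ℂ _)
      (S.comul a)
    have h2 := map_map ι.toContinuousLinearMap
      (CompletedTensor.map ι.toContinuousLinearMap ι.toContinuousLinearMap)
      (ContinuousLinearMap.id ℂ _) S.comul.toContinuousLinearMap (S.comul a)
    rw [ContinuousLinearMap.comp_id] at h1 h2
    rw [hΔ', map_map, map_map, hΔc, ContinuousLinearMap.id_comp, ← h1, ← h2, assoc_map,
      S.coassoc]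
  · refine ContinuousLinearMap.eq_of_denseRange h.denseRange
      (f := (CompletedTensor.map ε.toContinuousLinearMap (ContinuousLinearMap.id ℂ A)).comp
        Δ.toContinuousLinearMap)
      (g := ctmulLeft A (1 : ℂ)) fun a => ?_
    change CompletedTensor.map ε.toContinuousLinearMap (ContinuousLinearMap.id ℂ A) (Δ (ι a)) =
      ctmul (1 : ℂ) (ι a)
    have h1 := map_map (ContinuousLinearMap.id ℂ ℂ) ι.toContinuousLinearMap
      S.counit.toContinuousLinearMap (ContinuousLinearMap.id ℂ _) (S.comul a)
    rw [ContinuousLinearMap.comp_id, ContinuousLinearMap.id_comp] at h1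
    rw [hΔ', map_map, hεc, ContinuousLinearMap.id_comp, ← h1, S.counit_comul_left, map_ctmul]
    rfl
  · refine ContinuousLinearMap.eq_of_denseRange h.denseRange
      (f := (CompletedTensor.map (ContinuousLinearMap.id ℂ A) ε.toContinuousLinearMap).comp
        Δ.toContinuousLinearMap)
      (g := ctmulRight A (1 : ℂ)) fun a => ?_
    change CompletedTensor.map (ContinuousLinearMap.id ℂ A) ε.toContinuousLinearMap (Δ (ι a)) =
      ctmul (ι a) (1 : ℂ)
    have h1 := map_map ι.toContinuousLinearMap (ContinuousLinearMap.id ℂ ℂ)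
      (ContinuousLinearMap.id ℂ _) S.counit.toContinuousLinearMap (S.comul a)
    rw [ContinuousLinearMap.comp_id, ContinuousLinearMap.id_comp] at h1
    rw [hΔ', map_map, hεc, ContinuousLinearMap.id_comp, ← h1, S.counit_comul_right, map_ctmul]
    rfl
  · refine ContinuousLinearMap.eq_of_denseRange h.denseRange
      (f := (mulMap A).comp ((CompletedTensor.map T (ContinuousLinearMap.id ℂ A)).comp
        Δ.toContinuousLinearMap))
      (g := (algebraMapCLM ℂ A).comp ε.toContinuousLinearMap) fun a => ?_
    change mulMap A (CompletedTensor.map T (ContinuousLinearMap.id ℂ A) (Δ (ι a))) =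
      algebraMap ℂ A (ε (ι a))
    have h1 := map_map ι.toContinuousLinearMap ι.toContinuousLinearMap S.antipode
      (ContinuousLinearMap.id ℂ _) (S.comul a)
    rw [ContinuousLinearMap.comp_id] at h1
    rw [hΔ', map_map, hTc, ContinuousLinearMap.id_comp, ← h1, map_mulMap, S.antipode_left, hιc, hε]
  · refine ContinuousLinearMap.eq_of_denseRange h.denseRange
      (f := (mulMap A).comp ((CompletedTensor.map (ContinuousLinearMap.id ℂ A) T).comp
        Δ.toContinuousLinearMap))
      (g := (algebraMapCLM ℂ A).comp ε.toContinuousLinearMap) fun a => ?_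
    change mulMap A (CompletedTensor.map (ContinuousLinearMap.id ℂ A) T (Δ (ι a))) =
      algebraMap ℂ A (ε (ι a))
    have h1 := map_map ι.toContinuousLinearMap ι.toContinuousLinearMap
      (ContinuousLinearMap.id ℂ _) S.antipode (S.comul a)
    rw [ContinuousLinearMap.comp_id] at h1
    rw [hΔ', map_map, hTc, ContinuousLinearMap.id_comp, ← h1, map_mulMap, S.antipode_right, hιc,
      hε]

end EnvelopeHopf

end

theorem proposition1p2 (H : Type u) [Ring H] [HopfAlgebra ℂ H] [Algebra.FiniteType ℂ H] :
    ∃ (_ : ProjAlgebra (FinestLC H)) (hopfH : HopfProjAlgebra (FinestLC H)),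
      IsInducedByHopf hopfH ∧
      (∃ (A : Type u) (_ : Ring A) (_ : Algebra ℂ A) (_ : UniformSpace A)
        (_ : ArensMichaelAlgebra A) (ι : FinestLC H →A[ℂ] A), IsArensMichaelEnvelope ι) ∧
      ∀ (A : Type u) [Ring A] [Algebra ℂ A] [UniformSpace A] [ArensMichaelAlgebra A]
        (ι : FinestLC H →A[ℂ] A), IsArensMichaelEnvelope ι →
          IsHFG A ∧ ∃ hopfA : HopfProjAlgebra A, IsHopfHom hopfH hopfA ι := by
  refine ⟨inferInstance, FinestLC.hopfProjAlgebra H, FinestLC.isInducedByHopf H,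
    ⟨_, _, _, _, inferInstance, SubmultTop.toCompletion H, SubmultTop.isArensMichaelEnvelope H⟩, ?_⟩
  intro A _ _ _ _ ι h
  exact ⟨h.isHFG, HopfProjAlgebra.exists_of_envelope h⟩
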